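/- Let $H$ and $V$ be real separable Hilbert spaces with $V$ continuously and densely embedded in $H$; identify $H$ with its dual, so that $V\hookrightarrow H=H'\hookrightarrow V'$. Let $A_2:V\to V'$ be given by $\langle A_2u,v\rangle=(u,v)_V$. For $j=1,\dots,J$ let $(X_j,\mathcal A_j,\mu_j)$ be a measure space with $\mu_j(X_j)<\infty$, let $U_j$ be a closed subspace of $L^2(X_j,\mu_j)^{N_j}$, and let $g_j:\mathbb R^{N_j}\to\mathbb R^{N_j}$ be continuous with $(g_j(x)-g_j(y))\cdot(x-y)\ge 0$ for all $x,y$, $g_j(0)=0$, and $|g_j(x)|\le M(1+|x|)$ for all $x$ and some constant $M>0$. Let $J_U:V\to U=\prod_{j=1}^J U_j$ be linear and continuous, and define the nonlinear operator $B_2:V\to V'$ by $$\langle B_2u,v\rangle=\sum_{j=1}^J\int_{X_j}g_j\big((J_Uu)_j(x)\big)\cdot(J_Uv)_j(x)\,d\mu_j(x),\qquad u,v\in V.$$ Let $\alpha\in C^1([0,\infty),(0,\infty))$ be such that $\alpha'$ is Lipschitz continuous on $[0,T]$ for every $T>0$. Then for all $(u_0,u_1)\in V\times V$ with $A_2u_0+\alpha(0)B_2u_1\in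 H$, the problem $$u''(t)+A_2u(t)+\alpha(t)B_2u'(t)=0\ \text{ in }H,\ t\ge 0,\qquad u(0)=u_0,\quad u'(0)=u_1,$$ has a unique solution $u\in C([0,\infty),V)\cap C^1([0,\infty),H)$, in the following sense: $u(0)=u_0$, $u'(0)=u_1$; for every $t\ge0$, $u'(t)\in V$ and $A_2u(t)+\alpha(t)B_2u'(t)\in H$; and for all $t\ge 0$ outside a countable set (which may depend on $u$), the second derivative $u''(t)=-A_2u(t)-\alpha(t)B_2u'(t)$ exists in $H$ and the function $s\mapsto A_2u(s)+\alpha(s)B_2u'(s)\in H$ is continuous at $t$. -/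

import Mathlib

open Set MeasureTheory
open scoped RealInnerProductSpace

noncomputable section

/-- A feedback `g : ℝⁿ → ℝⁿ`: continuous, monotone, vanishing at `0`, of at most linear growth. -/
structure Feedback (n : ℕ) where
  toFun : EuclideanSpace ℝ (Fin n) → EuclideanSpace ℝ (Fin n)
  continuous_toFun : Continuous toFun
  monotone : ∀ x y, 0 ≤ ⟪toFun x - toFun y, x - y⟫
  map_zero : toFun 0 = 0
  growth : ∃ M : ℝ, 0 < M ∧ ∀ x, ‖toFun x‖ ≤ M * (1 + ‖x‖)

/-- The space `L²(X, μ)ⁿ` of square integrable functions with values in `ℝⁿ`. -/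
abbrev L2 {X : Type*} [MeasurableSpace X] (μ : Measure X) (n : ℕ) : Type _ :=
  Lp (EuclideanSpace ℝ (Fin n)) 2 μ

/-- On a finite measure space, `g ∘ f` is square integrable whenever `f` is. -/
theorem Feedback.memLp_comp {X : Type*} [MeasurableSpace X] {μ : Measure X} [IsFiniteMeasure μ]
    {n : ℕ} (g : Feedback n) (f : L2 μ n) : MemLp (fun x => g.toFun (f x)) 2 μ := by
  obtain ⟨M, hM, hg⟩ := g.growth
  have h1 : MemLp (fun x => M * (1 + ‖f x‖)) 2 μ :=
    ((memLp_const (1 : ℝ)).add (Lp.memLp f).norm).const_mul M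
  refine h1.mono (g.continuous_toFun.comp_aestronglyMeasurable (Lp.memLp f).1) ?_
  refine Filter.Eventually.of_forall fun x => (hg (f x)).trans ?_
  exact le_abs_self _

/-- The superposition operator `f ↦ g ∘ f` on `L²(X, μ)ⁿ`. -/
def Feedback.superposition {X : Type*} [MeasurableSpace X] {μ : Measure X} [IsFiniteMeasure μ]
    {n : ℕ} (g : Feedback n) (f : L2 μ n) : L2 μ n :=
  (g.memLp_comp f).toLp

/-- The operator `A₂ : V → V'`, `⟨A₂ u, v⟩ = (u, v)_V`. -/
def stiffness (V : Type*) [NormedAddCommGroup V] [InnerProductSpace ℝ V] :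
    V →L[ℝ] StrongDual ℝ V :=
  innerSL ℝ

/-- The nonlinear operator `B₂ : V → V'` attached to feedbacks `g j` and to a continuous linear map
`JU : V → U = ∏ j, U j`, where `U j` is a subspace of `L²(X j, μ j)^(N j)`.
See `damping_apply` for the integral formula. -/
def damping {V : Type*} [NormedAddCommGroup V] [InnerProductSpace ℝ V] {J : ℕ}
    {X : Fin J → Type*} [∀ j, MeasurableSpace (X j)] {μ : ∀ j, Measure (X j)}
    [∀ j, IsFiniteMeasure (μ j)] {N : Fin J → ℕ} {U : ∀ j, Submodule ℝ (L2 (μ j) (N j))}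
    (g : ∀ j, Feedback (N j)) (JU : V →L[ℝ] (∀ j, U j)) (u : V) : StrongDual ℝ V :=
  ∑ j, (innerSL ℝ ((g j).superposition (JU u j : L2 (μ j) (N j)))) ∘L
    (U j).subtypeL ∘L (ContinuousLinearMap.proj j) ∘L JU

/-- `⟨B₂ u, v⟩ = ∑ j, ∫_{X j} g j ((JU u) j x) · (JU v) j x dμ j(x)`. -/
theorem damping_apply {V : Type*} [NormedAddCommGroup V] [InnerProductSpace ℝ V] {J : ℕ}
    {X : Fin J → Type*} [∀ j, MeasurableSpace (X j)] {μ : ∀ j, Measure (X j)}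
    [∀ j, IsFiniteMeasure (μ j)] {N : Fin J → ℕ} {U : ∀ j, Submodule ℝ (L2 (μ j) (N j))}
    (g : ∀ j, Feedback (N j)) (JU : V →L[ℝ] (∀ j, U j)) (u v : V) :
    damping g JU u v =
      ∑ j, ∫ x, ⟪(g j).toFun ((JU u j : L2 (μ j) (N j)) x), (JU v j : L2 (μ j) (N j)) x⟫
        ∂(μ j) := by
  simp only [damping, sum_apply]
  refine Finset.sum_congr rfl fun j _ => ?_
  change ⟪(g j).superposition (JU u j : L2 (μ j) (N j)), (JU v j : L2 (μ j) (N j))⟫ = _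
  rw [L2.inner_def]
  refine integral_congr_ae ?_
  filter_upwards [((g j).memLp_comp (JU u j : L2 (μ j) (N j))).coeFn_toLp] with x hx
  simp only [Feedback.superposition]
  rw [hx]

/-- The inclusion `H = H' → V'` dual to the embedding `ι : V → H`: `⟨h, v⟩ = (h, ι v)_H`. -/
def pivot {V H : Type*} [NormedAddCommGroup V] [InnerProductSpace ℝ V]
    [NormedAddCommGroup H] [InnerProductSpace ℝ H] (ι : V →L[ℝ] H) (h : H) : StrongDual ℝ V :=
  (innerSL ℝ h) ∘L ι

/-- `u ∈ C([0,∞), V) ∩ C¹([0,∞), H)` solves `u'' + A u + α(t) B u' = 0` in `H`, `u(0) = u₀`,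
`u'(0) = u₁`. Here `v = u'`, which takes its values in `V`, and `f(t) ∈ H` is the element
`A u(t) + α(t) B u'(t)` of `V'`, which lies in `H` for all `t ≥ 0`; for all `t ≥ 0` outside a
countable set, `u''(t) = -f(t)` exists in `H` and is continuous at `t`.
Only the values of `u` on `[0,∞)` matter, and derivatives at `0` are one-sided. -/
def IsSolution {V H : Type*} [NormedAddCommGroup V] [InnerProductSpace ℝ V]
    [NormedAddCommGroup H] [InnerProductSpace ℝ H] (ι : V →L[ℝ] H)
    (A B : V → StrongDual ℝ V) (α : ℝ → ℝ) (u₀ u₁ : V) (u : ℝ → V) : Prop :=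
  ContinuousOn u (Ici 0) ∧ u 0 = u₀ ∧
  ∃ v : ℝ → V,
    (∀ t ∈ Ici (0 : ℝ), HasDerivWithinAt (fun s => ι (u s)) (ι (v t)) (Ici 0) t) ∧
    ContinuousOn (fun t => ι (v t)) (Ici 0) ∧ v 0 = u₁ ∧
    ∃ f : ℝ → H,
      (∀ t ∈ Ici (0 : ℝ), pivot ι (f t) = A (u t) + α t • B (v t)) ∧
      ∃ S : Set ℝ, S.Countable ∧ ∀ t ∈ Ici (0 : ℝ) \ S,
        HasDerivWithinAt (fun s => ι (v s)) (-f t) (Ici 0) t ∧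
        ContinuousWithinAt f (Ici 0) t

end

/-! With `v = u'` and `f = A u + α B v`, the problem is the first-order system `u' = v`, `v' = -f`
in `V × H`. For constant `α` it is a contraction: in the energy of a difference of two solutions the
`A` terms cancel and monotonicity of `B` gives the sign. Maximal monotonicity enters in two
elementary forms. `exists_inner_add_monotone_eq_zero` solves each backward Euler step. Minty's
lemma, through `StateEq.exists_limit`, passes the identity `f = A u + α B v` to bounded limits
without any compactness of `V → H`.

The dependence of `α` on time affects the bound on `v` in `V` and `f` in `H`. Comparing two
consecutive steps directly leaves a term `(α' - α) B v` paired with a difference of velocities that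
is not small in `V`. Dividing by `α` removes it: `f / α = A (u / α) + B v`, so the moving
coefficient falls on the linear part only. The quantity to bound is therefore `rate`, the size of
`(u / α)'` and of `f / α`; `rate + K`, with `K` a bound of the energy, grows at most exponentially.
This is where the second-order expansion of `1 / α`, hence the Lipschitz continuity of `α'`, is
used.

With these bounds, the schemes of steps `h` and `h / 2` differ by `O(√h)` in `V × H`, so the dyadic
schemes converge. The limit has a weak derivative `v' = -f` at every time, and inherits the bound on
`rate` by weak lower semicontinuity.

Uniqueness is delicate because a solution is not assumed to have `v` bounded in `V`, and satisfies
`v' = -f` only off a countable set. If `v` is bounded in `V`, the energy of the difference of two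
solutions is continuous with nonpositive left Dini derivative off a countable set, so it does not
increase. Local boundedness comes from Baire's theorem on the closed set `Z` of bad times: on a
relatively open part of `Z` both `v` and `f` are bounded, and between points of `Z` the rate bound,
restarted from the last bad time, propagates this bound, so no bad time exists.

Finally, the rate bound from every starting time makes `exp(-c t) (rate + K)` nonincreasing on
compact intervals, hence continuous off a countable set. Where `rate` is continuous, weak
convergence together with convergence of norms makes `f` strongly continuous, and the weak
derivative of `v` is then strong. -/

noncomputable section

open Filter Topology

/-! ### Monotone operators: Minty's lemma and surjectivity through the Fitzpatrick function. -/

section Monotone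

variable {V : Type*} [NormedAddCommGroup V] [InnerProductSpace ℝ V]

/-- Directional continuity from the right, at every point, in the direction of the test vector. -/
def Hemicontinuous (B : V → StrongDual ℝ V) : Prop :=
  ∀ x h : V, Tendsto (fun t : ℝ => B (x + t • h) h) (𝓝[>] 0) (𝓝 (B x h))

/-- Minty's lemma: the graph of a hemicontinuous operator contains every functional that is
monotonically related to it. -/
theorem Hemicontinuous.eq_of_monotone_related {B : V → StrongDual ℝ V} (hB : Hemicontinuous B)
    {l : StrongDual ℝ V} {v : V} (h : ∀ p, 0 ≤ (l - B p) (v - p)) : l = B v := by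
  have key : ∀ y : V, l y ≤ B v y := by
    intro y
    -- Testing with `p = v + t • y` and dividing by `t > 0` gives `l y ≤ B (v + t • y) y`.
    refine ge_of_tendsto (hB v y) ?_
    filter_upwards [self_mem_nhdsWithin] with t ht
    have h1 := h (v + t • y)
    have ht' : (0 : ℝ) < t := ht
    simp only [sub_add_cancel_left, map_neg, map_smul, sub_apply, smul_eq_mul] at h1
    by_contra hlt
    push Not at hlt
    nlinarith [mul_pos ht' (sub_pos.2 hlt)]
  ext y
  refine le_antisymm (key y) ?_
  have := key (-y)
  simp only [map_neg] at this
  linarith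

/-- A quadratic functional `r + (‖x‖² + ‖y‖²) / 2` attains its infimum on a nonempty closed convex
set on which it is bounded below. -/
theorem exists_isMinOn_add_half_norm_sq [CompleteSpace V] {E : Set (V × V × ℝ)}
    (hne : E.Nonempty) (hcl : IsClosed E) (hcv : Convex ℝ E)
    (hbd : ∀ p ∈ E, 0 ≤ p.2.2 + (‖p.1‖ ^ 2 + ‖p.2.1‖ ^ 2) / 2) :
    ∃ p ∈ E, ∀ p' ∈ E, p.2.2 + (‖p.1‖ ^ 2 + ‖p.2.1‖ ^ 2) / 2 ≤
      p'.2.2 + (‖p'.1‖ ^ 2 + ‖p'.2.1‖ ^ 2) / 2 := by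
  set q : V × V × ℝ → ℝ := fun p => p.2.2 + (‖p.1‖ ^ 2 + ‖p.2.1‖ ^ 2) / 2 with hq
  have hbb : BddBelow (q '' E) := ⟨0, by rintro _ ⟨p, hp, rfl⟩; exact hbd p hp⟩
  set m := sInf (q '' E) with hm
  have hmle : ∀ p ∈ E, m ≤ q p := fun p hp => csInf_le hbb ⟨p, hp, rfl⟩
  have hex : ∀ n : ℕ, ∃ p ∈ E, q p < m + (1 / 2) ^ n := by
    intro n
    obtain ⟨_, ⟨p, hp, rfl⟩, hlt⟩ := exists_lt_of_csInf_lt (hne.image q)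
      (show sInf (q '' E) < m + (1 / 2) ^ n by rw [← hm]; linarith [show (0:ℝ) < (1/2)^n by positivity])
    exact ⟨p, hp, hlt⟩
  choose s hsE hsq using hex
  -- The midpoint of two points of a minimising sequence stays in `E`, so its value is at least `m`;
  -- the parallelogram law turns this into a Cauchy estimate for the two vector components.
  have hpar : ∀ i j, ‖(s i).1 - (s j).1‖ ^ 2 + ‖(s i).2.1 - (s j).2.1‖ ^ 2 ≤
      4 * ((1 / 2) ^ i + (1 / 2) ^ j) := by
    intro i j
    have hmid := hmle _ (hcv (hsE i) (hsE j) (show (0:ℝ) ≤ 1/2 by norm_num)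
      (show (0:ℝ) ≤ 1/2 by norm_num) (by norm_num))
    have e : ∀ a b : V, ‖(1/2 : ℝ) • a + (1/2 : ℝ) • b‖ ^ 2 =
        (‖a‖ ^ 2 + ‖b‖ ^ 2) / 2 - ‖a - b‖ ^ 2 / 4 := by
      intro a b
      rw [← smul_add, norm_smul, mul_pow]
      have := parallelogram_law_with_norm ℝ a b
      rw [Real.norm_of_nonneg (by norm_num)]
      nlinarith
    have h1 := hsq i
    have h2 := hsq j
    simp only [hq, Prod.fst_add, Prod.snd_add, Prod.smul_fst, Prod.smul_snd, e, smul_eq_mul]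
      at hmid h1 h2
    linarith
  have hdec : Tendsto (fun n : ℕ => 4 * ((1 / 2 : ℝ) ^ n + (1 / 2) ^ n)) atTop (𝓝 0) := by
    have := tendsto_pow_atTop_nhds_zero_of_lt_one (r := (1/2 : ℝ)) (by norm_num) (by norm_num)
    simpa using (this.add this).const_mul 4
  have hcau : ∀ x : ℕ → V, (∀ i j, ‖x i - x j‖ ^ 2 ≤ 4 * ((1 / 2 : ℝ) ^ i + (1 / 2) ^ j)) →
      ∃ y, Tendsto x atTop (𝓝 y) := by
    intro x hx
    refine cauchySeq_tendsto_of_complete (cauchySeq_of_le_tendsto_0'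
      (fun n : ℕ => Real.sqrt (4 * ((1 / 2 : ℝ) ^ n + (1 / 2) ^ n))) ?_ ?_)
    · intro n k hnk
      rw [dist_eq_norm]
      refine Real.le_sqrt_of_sq_le ((hx n k).trans ?_)
      have : (1 / 2 : ℝ) ^ k ≤ (1 / 2) ^ n :=
        pow_le_pow_of_le_one (by norm_num) (by norm_num) hnk
      linarith
    · simpa using hdec.sqrt
  obtain ⟨x, hx⟩ := hcau (fun n => (s n).1) fun i j =>
    (le_add_of_nonneg_right (sq_nonneg _)).trans (hpar i j)
  obtain ⟨y, hy⟩ := hcau (fun n => (s n).2.1) fun i j =>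
    (le_add_of_nonneg_left (sq_nonneg _)).trans (hpar i j)
  have hqm : Tendsto (fun n => q (s n)) atTop (𝓝 m) := by
    refine tendsto_of_tendsto_of_tendsto_of_le_of_le tendsto_const_nhds ?_
      (fun n => hmle _ (hsE n)) (fun n => (hsq n).le)
    simpa using (tendsto_pow_atTop_nhds_zero_of_lt_one (r := (1/2 : ℝ)) (by norm_num)
      (by norm_num)).const_add m
  -- The real component has no Cauchy estimate of its own; it converges because the value and both
  -- norms do.
  have hr : Tendsto (fun n => (s n).2.2) atTop (𝓝 (m - (‖x‖ ^ 2 + ‖y‖ ^ 2) / 2)) := by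
    refine (hqm.sub (((hx.norm.pow 2).add (hy.norm.pow 2)).div_const 2)).congr fun n => ?_
    simp [hq]
  refine ⟨(x, y, m - (‖x‖ ^ 2 + ‖y‖ ^ 2) / 2), hcl.mem_of_tendsto
    (hx.prodMk_nhds (hy.prodMk_nhds hr)) (Eventually.of_forall hsE), fun p' hp' => ?_⟩
  have := hmle p' hp'
  simp only [hq] at this
  simpa using this

/-- A monotone hemicontinuous everywhere defined operator `T` on a Hilbert space is such that
`1 + T` vanishes somewhere: minimise `F + ‖·‖² / 2`, with `F` the Fitzpatrick function of `T`. -/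
theorem exists_inner_add_monotone_eq_zero [CompleteSpace V] {T : V → StrongDual ℝ V}
    (hT : Hemicontinuous T) (hmono : ∀ x y, 0 ≤ (T x - T y) (x - y)) :
    ∃ x, ∀ y, ⟪x, y⟫ + T x y = 0 := by
  set R : V → V := fun x => (InnerProductSpace.toDual ℝ V).symm (T x) with hR
  have hRi : ∀ x y, ⟪R x, y⟫ = T x y := fun x y => InnerProductSpace.toDual_symm_apply
  have hRm : ∀ x y, 0 ≤ ⟪R x - R y, x - y⟫ := by
    intro x y
    rw [inner_sub_left, hRi, hRi]
    simpa using hmono x y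
  -- The epigraph of the Fitzpatrick function of `R`, the Riesz representative of `T`. This function
  -- dominates `⟪x, y⟫` (`hdiag`) and equals it on the graph of `R`, where monotonicity gives the
  -- upper bound (`hgraph`).
  set E : Set (V × V × ℝ) := {p | ∀ z, ⟪R z, p.1⟫ + ⟪z, p.2.1⟫ - ⟪R z, z⟫ ≤ p.2.2} with hE
  have hgraph : ∀ z, ((z, R z, ⟪R z, z⟫) : V × V × ℝ) ∈ E := by
    intro z z'
    have := hRm z z'
    simp only [inner_sub_left, inner_sub_right] at this
    have h2 := real_inner_comm z' (R z)
    simp only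
    linarith
  have hdiag : ∀ p ∈ E, ⟪p.1, p.2.1⟫ ≤ p.2.2 := by
    intro p hp
    have := hp p.1
    linarith
  have hsq : ∀ a b : V, ‖a + b‖ ^ 2 = ‖a‖ ^ 2 + 2 * ⟪a, b⟫ + ‖b‖ ^ 2 := norm_add_sq_real
  have hcl : IsClosed E := by
    simp only [hE, ofPred_forall]
    refine isClosed_iInter fun z => isClosed_le (by fun_prop) (by fun_prop)
  have hcv : Convex ℝ E := by
    intro p hp p' hp' a b ha hb hab z
    have h1 := mul_le_mul_of_nonneg_left (hp z) ha
    have h2 := mul_le_mul_of_nonneg_left (hp' z) hb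
    simp only [Prod.fst_add, Prod.snd_add, Prod.smul_fst, Prod.smul_snd, inner_add_right,
      inner_smul_right, smul_eq_mul]
    have h3 : ⟪R z, z⟫ = a * ⟪R z, z⟫ + b * ⟪R z, z⟫ := by rw [← add_mul, hab, one_mul]
    linarith
  obtain ⟨⟨x, y, r⟩, hp, hmin⟩ := exists_isMinOn_add_half_norm_sq ⟨_, hgraph 0⟩ hcl hcv (by
    intro p hp
    have := hdiag p hp
    have h2 := hsq p.1 p.2.1
    nlinarith [sq_nonneg ‖p.1 + p.2.1‖])
  simp only at hmin
  -- First-order optimality at the minimiser, from moving a distance `t → 0+` along the segment to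
  -- `p'`.
  have hvar : ∀ p' ∈ E, 0 ≤ p'.2.2 - r + ⟪x, p'.1 - x⟫ + ⟪y, p'.2.1 - y⟫ := by
    intro p' hp'
    have hlim : Tendsto (fun t : ℝ => p'.2.2 - r + ⟪x, p'.1 - x⟫ + ⟪y, p'.2.1 - y⟫ +
        t * ((‖p'.1 - x‖ ^ 2 + ‖p'.2.1 - y‖ ^ 2) / 2)) (𝓝[>] 0)
        (𝓝 (p'.2.2 - r + ⟪x, p'.1 - x⟫ + ⟪y, p'.2.1 - y⟫ +
        0 * ((‖p'.1 - x‖ ^ 2 + ‖p'.2.1 - y‖ ^ 2) / 2))) :=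
      ((tendsto_id.mul_const _).const_add _).mono_left nhdsWithin_le_nhds
    rw [zero_mul, add_zero] at hlim
    refine ge_of_tendsto hlim ?_
    filter_upwards [Ioo_mem_nhdsGT (show (0:ℝ) < 1 by norm_num)] with t ht
    have hm := hmin _ (hcv.add_smul_sub_mem hp hp' ⟨ht.1.le, ht.2.le⟩)
    simp only [Prod.fst_add, Prod.snd_add, Prod.smul_fst, Prod.smul_snd, Prod.fst_sub,
      Prod.snd_sub, hsq, norm_smul, inner_smul_right, smul_eq_mul, mul_pow, Real.norm_eq_abs,
      sq_abs] at hm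
    have : 0 ≤ t * (p'.2.2 - r + ⟪x, p'.1 - x⟫ + ⟪y, p'.2.1 - y⟫ +
        t * ((‖p'.1 - x‖ ^ 2 + ‖p'.2.1 - y‖ ^ 2) / 2)) := by linarith
    exact (mul_nonneg_iff_of_pos_left ht.1).1 this
  have hkey : ∀ z, ‖x + y‖ ^ 2 ≤ ⟪R z + x, z + y⟫ := by
    intro z
    have h1 := hvar _ (hgraph z)
    have h2 := hdiag _ hp
    simp only [inner_sub_right, real_inner_self_eq_norm_sq] at h1 h2
    rw [hsq, inner_add_left, inner_add_right, inner_add_right]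
    have h3 := real_inner_comm y (R z)
    linarith
  -- By `hkey`, `-x` is monotonically related at `-y` to the whole graph, hence lies on it. Then `z
  -- = -y` in `hkey` forces `x + y = 0`.
  have hx : innerSL ℝ (-x) = T (-y) := by
    refine hT.eq_of_monotone_related fun p => ?_
    have := (sq_nonneg _).trans (hkey p)
    rw [inner_add_left, inner_add_right, inner_add_right, hRi, hRi] at this
    simp only [sub_apply, map_sub, map_neg, neg_apply, innerSL_apply_apply]
    linarith
  have h0 : x + y = 0 := by
    have h1 := hkey (-y)
    simp only [neg_add_cancel, inner_zero_right] at h1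
    exact norm_eq_zero.1 (by nlinarith [norm_nonneg (x + y)])
  have hxy : -y = x := by rw [neg_eq_iff_add_eq_zero, add_comm, h0]
  refine ⟨x, fun z => ?_⟩
  rw [hxy] at hx
  rw [← hx]
  simp

end Monotone

/-! ### Weak convergence along filters. -/

section Weak

variable {E : Type*} [NormedAddCommGroup E] [InnerProductSpace ℝ E] {I : Type*}

/-- Weak convergence along a filter in an inner product space. -/
def WeaklyTendsto (x : I → E) (F : Filter I) (y : E) : Prop :=
  ∀ z, Tendsto (fun i => ⟪x i, z⟫) F (𝓝 ⟪y, z⟫)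

theorem Filter.Tendsto.weaklyTendsto {x : I → E} {F : Filter I} {y : E}
    (h : Tendsto x F (𝓝 y)) : WeaklyTendsto x F y :=
  fun _ => h.inner tendsto_const_nhds

theorem WeaklyTendsto.add {x x' : I → E} {F : Filter I} {y y' : E} (h : WeaklyTendsto x F y)
    (h' : WeaklyTendsto x' F y') : WeaklyTendsto (fun i => x i + x' i) F (y + y') := fun z => by
  simpa only [inner_add_left] using (h z).add (h' z)

theorem WeaklyTendsto.smul {x : I → E} {F : Filter I} {y : E} (h : WeaklyTendsto x F y)
    {c : I → ℝ} {a : ℝ} (hc : Tendsto c F (𝓝 a)) :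
    WeaklyTendsto (fun i => c i • x i) F (a • y) := fun z => by
  simpa only [real_inner_smul_left] using hc.mul (h z)

theorem WeaklyTendsto.unique {x : I → E} {F : Filter I} [F.NeBot] {y y' : E}
    (h : WeaklyTendsto x F y) (h' : WeaklyTendsto x F y') : y = y' :=
  ext_inner_right ℝ fun z => tendsto_nhds_unique (h z) (h' z)

theorem WeaklyTendsto.inner {x w : I → E} {F : Filter I} {y z : E} {L : ℝ}
    (h : WeaklyTendsto x F y) (hL : ∀ᶠ i in F, ‖x i‖ ≤ L) (hw : Tendsto w F (𝓝 z)) :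
    Tendsto (fun i => ⟪x i, w i⟫) F (𝓝 ⟪y, z⟫) := by
  have h0 : Tendsto (fun i => ⟪x i, w i - z⟫) F (𝓝 0) := by
    have h1 : Tendsto (fun i => L * ‖w i - z‖) F (𝓝 0) := by
      simpa using (tendsto_iff_norm_sub_tendsto_zero.1 hw).const_mul L
    refine squeeze_zero_norm' ?_ h1
    filter_upwards [hL] with i hi
    exact (norm_inner_le_norm _ _).trans (mul_le_mul_of_nonneg_right hi (norm_nonneg _))
  refine (by simpa using (h z).add h0 : Tendsto _ F (𝓝 ⟪y, z⟫)).congr fun i => ?_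
  rw [← inner_add_right]
  congr 1
  abel

theorem weaklyTendsto_of_ultrafilter {x : I → E} {F : Filter I} {y : E}
    (h : ∀ 𝒰 : Ultrafilter I, (𝒰 : Filter I) ≤ F → WeaklyTendsto x 𝒰 y) : WeaklyTendsto x F y :=
  fun z => tendsto_iff_ultrafilter _ _ _ |>.2 fun 𝒰 h𝒰 => h 𝒰 h𝒰 z

/-- Bounded families have weak limits along ultrafilters. -/
theorem Ultrafilter.exists_weaklyTendsto [CompleteSpace E] (𝒰 : Ultrafilter I) {x : I → E} {L : ℝ}
    (hL : ∀ᶠ i in (𝒰 : Filter I), ‖x i‖ ≤ L) : ∃ y, ‖y‖ ≤ L ∧ WeaklyTendsto x 𝒰 y := by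
  set X : I → WeakDual ℝ E := fun i =>
    StrongDual.toWeakDual (InnerProductSpace.toDual ℝ E (x i)) with hX
  have hK := WeakDual.isCompact_closedBall (0 : StrongDual ℝ E) L
  obtain ⟨l, hl, hlim⟩ := hK.ultrafilter_le_nhds (𝒰.map X) (by
    rw [le_principal_iff, Ultrafilter.coe_map, Filter.mem_map]
    filter_upwards [hL] with i hi
    simp only [mem_preimage, hX, Metric.mem_closedBall, dist_zero_right]
    exact ((InnerProductSpace.toDual ℝ E).norm_map (x i)).trans_le hi)
  refine ⟨(InnerProductSpace.toDual ℝ E).symm (WeakDual.toStrongDual l), ?_, fun z => ?_⟩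
  · rw [LinearIsometryEquiv.norm_map]
    simpa using hl
  · rw [InnerProductSpace.toDual_symm_apply]
    exact ((WeakDual.eval_continuous z).tendsto l).comp hlim

theorem WeaklyTendsto.norm_sq_add_le {E' : Type*} [NormedAddCommGroup E'] [InnerProductSpace ℝ E']
    {F : Filter I} [F.NeBot] {p : I → E} {q : I → E'} {p₀ : E} {q₀ : E'} {C : I → ℝ} {C₀ : ℝ}
    (hp : WeaklyTendsto p F p₀) (hq : WeaklyTendsto q F q₀)
    (hle : ∀ᶠ i in F, ‖p i‖ ^ 2 + ‖q i‖ ^ 2 ≤ C i) (hC : Tendsto C F (𝓝 C₀)) :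
    ‖p₀‖ ^ 2 + ‖q₀‖ ^ 2 ≤ C₀ := by
  have h := le_of_tendsto_of_tendsto ((hp p₀).add (hq q₀))
    ((hC.div_const 2).add_const ((‖p₀‖ ^ 2 + ‖q₀‖ ^ 2) / 2)) (by
      filter_upwards [hle] with i hi
      have h1 := norm_sub_sq_real (p i) p₀
      have h2 := norm_sub_sq_real (q i) q₀
      nlinarith [sq_nonneg ‖p i - p₀‖, sq_nonneg ‖q i - q₀‖])
  simp only [real_inner_self_eq_norm_sq] at h
  linarith

/-- Expanding squares, `‖p - p₀‖² + ‖q - q₀‖²` tends to `0`. Only the joint norm has to converge,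
which is all that continuity of `rate` provides. -/
theorem WeaklyTendsto.tendsto_of_norm_sq_add {E' : Type*} [NormedAddCommGroup E']
    [InnerProductSpace ℝ E'] {F : Filter I} {p : I → E} {q : I → E'} {p₀ : E} {q₀ : E'}
    (hp : WeaklyTendsto p F p₀) (hq : WeaklyTendsto q F q₀)
    (h : Tendsto (fun i => ‖p i‖ ^ 2 + ‖q i‖ ^ 2) F (𝓝 (‖p₀‖ ^ 2 + ‖q₀‖ ^ 2))) :
    Tendsto q F (𝓝 q₀) := by
  have h1 := (h.sub (((hp p₀).add (hq q₀)).const_mul 2)).add_const (‖p₀‖ ^ 2 + ‖q₀‖ ^ 2)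
  have h2 : Tendsto (fun i => ‖q i - q₀‖ ^ 2) F (𝓝 0) := by
    refine squeeze_zero (fun i => sq_nonneg _) (fun i => ?_) (h1.trans_eq ?_)
    · have h3 := norm_sub_sq_real (p i) p₀
      have h4 := norm_sub_sq_real (q i) q₀
      nlinarith [sq_nonneg ‖p i - p₀‖]
    · simp only [real_inner_self_eq_norm_sq]
      congr 1
      ring
  rw [tendsto_iff_norm_sub_tendsto_zero]
  simpa [Real.sqrt_sq] using h2.sqrt

end Weak

/-! ### The state equation `f = A u + a B v` and its stability under weak limits. -/

section State

variable {V H : Type*} [NormedAddCommGroup V] [InnerProductSpace ℝ V]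
  [NormedAddCommGroup H] [InnerProductSpace ℝ H] {ι : V →L[ℝ] H} {B : V → StrongDual ℝ V}
  {I : Type*} {F : Filter I}

theorem WeaklyTendsto.map [CompleteSpace V] [CompleteSpace H] (ι : V →L[ℝ] H) {x : I → V} {y : V}
    (h : WeaklyTendsto x F y) : WeaklyTendsto (fun i => ι (x i)) F (ι y) := fun z => by
  simpa only [ContinuousLinearMap.adjoint_inner_right] using h (ι.adjoint z)

/-- In a bounded subset of `V`, weak convergence in `H` implies weak convergence in `V`. -/
theorem weaklyTendsto_of_map [CompleteSpace V] [CompleteSpace H] (hι : Function.Injective ι)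
    {x : I → V} {y : V} {L : ℝ} (hL : ∀ᶠ i in F, ‖x i‖ ≤ L)
    (h : WeaklyTendsto (fun i => ι (x i)) F (ι y)) : WeaklyTendsto x F y := by
  refine weaklyTendsto_of_ultrafilter fun 𝒰 h𝒰 => ?_
  obtain ⟨y', -, hy'⟩ := 𝒰.exists_weaklyTendsto (hL.filter_mono h𝒰)
  have : ι y' = ι y := (hy'.map ι).unique fun z => (h z).mono_left h𝒰
  rwa [← hι this]

/-- The orthogonal complement of the range of the adjoint is the kernel of `ι`. Tests against `H`
thus suffice for estimates in `V`. -/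
theorem denseRange_adjoint [CompleteSpace V] [CompleteSpace H] (hι : Function.Injective ι) :
    DenseRange ι.adjoint := by
  have h : (ι.adjoint.range).topologicalClosure = ⊤ := by
    rw [Submodule.topologicalClosure_eq_top_iff, Submodule.eq_bot_iff]
    intro v hv
    refine hι ?_
    rw [map_zero]
    refine ext_inner_left ℝ fun w => ?_
    have := hv (ι.adjoint w) ⟨w, rfl⟩
    rwa [ContinuousLinearMap.adjoint_inner_left, ← inner_zero_right (𝕜 := ℝ) w] at this
  rw [Submodule.topologicalClosure_eq_top_iff] at h
  have h2 := Submodule.dense_iff_topologicalClosure_eq_top.2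
    (Submodule.topologicalClosure_eq_top_iff.2 h)
  exact h2

/-- The identity `f = A u + a B v` in `V'`, with `f ∈ H`. -/
def StateEq (ι : V →L[ℝ] H) (B : V → StrongDual ℝ V) (a : ℝ) (u v : V) (f : H) : Prop :=
  ∀ x, ⟪f, ι x⟫ = ⟪u, x⟫ + a * B v x

theorem pivot_eq_iff {a : ℝ} {u v : V} {f : H} :
    pivot ι f = stiffness V u + a • B v ↔ StateEq ι B a u v f := by
  rw [ContinuousLinearMap.ext_iff]
  exact Iff.rfl

theorem StateEq.unique {a : ℝ} {u v : V} {f f' : H} (hι : DenseRange ι)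
    (h : StateEq ι B a u v f) (h' : StateEq ι B a u v f') : f = f' := by
  refine hι.eq_of_inner_left ℝ ?_
  intro x
  rw [h, h']

/-- Monotonicity of the state equation, for two different values of the coefficient. -/
theorem StateEq.inner_sub_le (hB : ∀ x y, 0 ≤ (B x - B y) (x - y)) {a a' : ℝ} {u v u' v' : V}
    {f f' : H} (ha : 0 ≤ a) (h : StateEq ι B a u v f) (h' : StateEq ι B a' u' v' f') :
    ⟪u - u', v - v'⟫ - ⟪f - f', ι (v - v')⟫ ≤ |a - a'| * (‖B v'‖ * ‖v - v'‖) := by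
  have h1 := mul_nonneg ha (hB v v')
  rw [inner_sub_left, inner_sub_left, h, h']
  have h2 : -((a - a') * B v' (v - v')) ≤ |a - a'| * (‖B v'‖ * ‖v - v'‖) := by
    refine (neg_le_abs _).trans ?_
    rw [abs_mul]
    exact mul_le_mul_of_nonneg_left ((B v').le_opNorm _) (abs_nonneg _)
  rw [sub_apply] at h1
  linarith

variable [CompleteSpace V] [CompleteSpace H]

/-- The pairings `⟪f, ι v⟫` and `⟪u, v⟫` each combine a bounded weakly convergent factor with a
strongly convergent one, so the monotonicity inequality against any fixed `p` survives in the limit.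
Minty's lemma then identifies the limit of the `B` term. The ultrafilter supplies weak limits
without extracting subsequences. -/
theorem StateEq.exists_limit_ultrafilter (hB : ∀ x y, 0 ≤ (B x - B y) (x - y))
    (hBh : Hemicontinuous B) {𝒰 : Ultrafilter I} {a : I → ℝ} {u v : I → V} {f : I → H} {a₀ : ℝ}
    {u₀ : V} {y : H} {L : ℝ} (h : ∀ᶠ i in (𝒰 : Filter I), StateEq ι B (a i) (u i) (v i) (f i))
    (hv : ∀ᶠ i in (𝒰 : Filter I), ‖v i‖ ≤ L) (hf : ∀ᶠ i in (𝒰 : Filter I), ‖f i‖ ≤ L)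
    (hu : Tendsto u 𝒰 (𝓝 u₀)) (hy : Tendsto (fun i => ι (v i)) 𝒰 (𝓝 y))
    (ha : Tendsto a 𝒰 (𝓝 a₀)) (ha₀ : 0 < a₀) :
    ∃ v₀ f₀, ι v₀ = y ∧ ‖v₀‖ ≤ L ∧ ‖f₀‖ ≤ L ∧ StateEq ι B a₀ u₀ v₀ f₀ ∧
      WeaklyTendsto v 𝒰 v₀ ∧ WeaklyTendsto f 𝒰 f₀ := by
  obtain ⟨v₀, hv₀, hvw⟩ := 𝒰.exists_weaklyTendsto hv
  obtain ⟨f₀, hf₀, hfw⟩ := 𝒰.exists_weaklyTendsto hf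
  have hιv : ι v₀ = y := (hvw.map ι).unique hy.weaklyTendsto
  refine ⟨v₀, f₀, hιv, hv₀, hf₀, ?_, hvw, hfw⟩
  have key : ∀ p, 0 ≤ ⟪f₀, ι v₀ - ι p⟫ - ⟪u₀, v₀ - p⟫ - a₀ * (B p v₀ - B p p) := by
    intro p
    have hBp : Tendsto (fun i => B p (v i)) 𝒰 (𝓝 (B p v₀)) := by
      have := hvw ((InnerProductSpace.toDual ℝ V).symm (B p))
      simpa only [real_inner_comm ((InnerProductSpace.toDual ℝ V).symm (B p)),
        InnerProductSpace.toDual_symm_apply] using this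
    have huv : Tendsto (fun i => ⟪u i, v i - p⟫) 𝒰 (𝓝 ⟪u₀, v₀ - p⟫) := by
      have := (hvw.inner hv hu).sub (hu.inner (tendsto_const_nhds (x := p)))
      simpa only [inner_sub_right, real_inner_comm] using this
    have hfv := hfw.inner hf (hy.sub_const (ι p))
    rw [← hιv] at hfv
    refine ge_of_tendsto ((hfv.sub huv).sub (ha.mul (hBp.sub_const (B p p)))) ?_
    filter_upwards [h, ha.eventually (lt_mem_nhds ha₀)] with i hi hai
    have h1 := mul_nonneg hai.le (hB (v i) p)
    rw [← map_sub, hi, ← map_sub]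
    rw [sub_apply] at h1
    linarith
  have hl : a₀⁻¹ • (pivot ι f₀ - innerSL ℝ u₀) = B v₀ := by
    refine hBh.eq_of_monotone_related fun p => ?_
    have := mul_nonneg (inv_nonneg.2 ha₀.le) (key p)
    rw [← map_sub, ← map_sub, mul_sub, inv_mul_cancel_left₀ ha₀.ne'] at this
    simpa [pivot] using this
  intro x
  have := congrArg (fun l : StrongDual ℝ V => a₀ * l x) hl
  simp only [smul_apply, sub_apply, smul_eq_mul, mul_inv_cancel_left₀ ha₀.ne'] at this
  rw [← this]
  simp [pivot]

/-- The set of solutions of the state equation is closed under bounded limits. -/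
theorem StateEq.exists_limit (hB : ∀ x y, 0 ≤ (B x - B y) (x - y))
    (hBh : Hemicontinuous B) [F.NeBot] {a : I → ℝ} {u v : I → V} {f : I → H} {a₀ : ℝ}
    {u₀ : V} {y : H} {L : ℝ} (h : ∀ᶠ i in F, StateEq ι B (a i) (u i) (v i) (f i))
    (hv : ∀ᶠ i in F, ‖v i‖ ≤ L) (hf : ∀ᶠ i in F, ‖f i‖ ≤ L)
    (hu : Tendsto u F (𝓝 u₀)) (hy : Tendsto (fun i => ι (v i)) F (𝓝 y))
    (ha : Tendsto a F (𝓝 a₀)) (ha₀ : 0 < a₀) :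
    ∃ v₀ f₀, ι v₀ = y ∧ ‖v₀‖ ≤ L ∧ ‖f₀‖ ≤ L ∧ StateEq ι B a₀ u₀ v₀ f₀ := by
  have hF := Ultrafilter.of_le F
  obtain ⟨v₀, f₀, h1, h2, h3, h4, -⟩ := StateEq.exists_limit_ultrafilter hB hBh
    (h.filter_mono hF) (hv.filter_mono hF) (hf.filter_mono hF) (hu.mono_left hF)
    (hy.mono_left hF) (ha.mono_left hF) ha₀
  exact ⟨v₀, f₀, h1, h2, h3, h4⟩

/-- Since `u` and `v` determine `f`, all ultrafilters yield the same limit, so the whole family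
converges weakly. -/
theorem StateEq.weaklyTendsto (hι : Function.Injective ι) (hιd : DenseRange ι)
    (hB : ∀ x y, 0 ≤ (B x - B y) (x - y)) (hBh : Hemicontinuous B) {a : I → ℝ} {u v : I → V}
    {f : I → H} {a₀ : ℝ} {u₀ v₀ : V} {f₀ : H} {L : ℝ}
    (h : ∀ᶠ i in F, StateEq ι B (a i) (u i) (v i) (f i))
    (hv : ∀ᶠ i in F, ‖v i‖ ≤ L) (hf : ∀ᶠ i in F, ‖f i‖ ≤ L)
    (hu : Tendsto u F (𝓝 u₀)) (hy : Tendsto (fun i => ι (v i)) F (𝓝 (ι v₀)))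
    (ha : Tendsto a F (𝓝 a₀)) (ha₀ : 0 < a₀) (h₀ : StateEq ι B a₀ u₀ v₀ f₀) :
    WeaklyTendsto v F v₀ ∧ WeaklyTendsto f F f₀ := by
  refine ⟨weaklyTendsto_of_map hι hv hy.weaklyTendsto,
    weaklyTendsto_of_ultrafilter fun 𝒰 hF => ?_⟩
  obtain ⟨v₁, f₁, h1, -, -, h4, -, h5⟩ := StateEq.exists_limit_ultrafilter hB hBh
    (h.filter_mono hF) (hv.filter_mono hF) (hf.filter_mono hF) (hu.mono_left hF)
    (hy.mono_left hF) (ha.mono_left hF) ha₀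
  obtain rfl := hι h1
  rwa [h₀.unique hιd h4]

end State

/-! ### Backward Euler scheme: solvability, a priori bounds, comparison of steps. -/

section Scheme

/-- Convexity of the square, based at the later point `x`. This sign suits an implicit scheme, and
also left difference quotients in the uniqueness proof. -/
theorem norm_sq_sub_norm_sq_le_two_inner {E : Type*} [NormedAddCommGroup E]
    [InnerProductSpace ℝ E] (x y : E) : ‖x‖ ^ 2 - ‖y‖ ^ 2 ≤ 2 * ⟪x, x - y⟫ := by
  rw [inner_sub_right, real_inner_self_eq_norm_sq]
  have := norm_sub_sq_real x y
  nlinarith [sq_nonneg ‖x - y‖]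

variable {V H : Type*} [NormedAddCommGroup V] [InnerProductSpace ℝ V]
  [NormedAddCommGroup H] [InnerProductSpace ℝ H] {ι : V →L[ℝ] H} {B : V → StrongDual ℝ V}

/-- The backward Euler scheme of step `h` for `u' = v`, `v' = -f`, `f = A u + α B v`. -/
structure IsScheme (ι : V →L[ℝ] H) (B : V → StrongDual ℝ V) (α : ℝ → ℝ) (h : ℝ)
    (u v : ℕ → V) (f : ℕ → H) : Prop where
  state : ∀ n : ℕ, StateEq ι B (α (n * h)) (u n) (v n) (f n)
  step_u : ∀ n, u (n + 1) = u n + h • v (n + 1)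
  step_v : ∀ n, ι (v (n + 1)) = ι (v n) - h • f (n + 1)

theorem exists_euler_step [CompleteSpace V] (hB : ∀ x y, 0 ≤ (B x - B y) (x - y))
    (hBh : Hemicontinuous B) {h a : ℝ} (hh : 0 < h) (ha : 0 < a) (u v : V) :
    ∃ v' f, StateEq ι B a (u + h • v') v' f ∧ ι v' = ι v - h • f := by
  -- Eliminating `f = (ι v - ι v') / h` from the state equation at `u + h • v'` and dividing by `h`
  -- leaves `v' + T v' = 0`.
  set T : V → StrongDual ℝ V := fun x => (h ^ 2)⁻¹ • (innerSL ℝ (ι x - ι v) ∘L ι) + (a / h) • B x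
    + h⁻¹ • innerSL ℝ u with hT
  have hTa : ∀ x y, T x y = (h ^ 2)⁻¹ * ⟪ι x - ι v, ι y⟫ + a / h * B x y + h⁻¹ * ⟪u, y⟫ :=
    fun x y => by simp [hT, inner_sub_left]
  have hTh : Hemicontinuous T := by
    intro x y
    simp only [hTa]
    refine ((tendsto_const_nhds.mul ?_).add ((hBh x y).const_mul _)).add tendsto_const_nhds
    have : Tendsto (fun t : ℝ => ⟪ι (x + t • y) - ι v, ι y⟫) (𝓝 0)
        (𝓝 ⟪ι (x + (0 : ℝ) • y) - ι v, ι y⟫) :=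
      Continuous.tendsto (by fun_prop) 0
    rw [zero_smul, add_zero] at this
    exact this.mono_left nhdsWithin_le_nhds
  have hTm : ∀ x y, 0 ≤ (T x - T y) (x - y) := by
    intro x y
    rw [sub_apply, hTa, hTa]
    have h1 : 0 ≤ (h ^ 2)⁻¹ * ⟪ι (x - y), ι (x - y)⟫ :=
      mul_nonneg (by positivity) real_inner_self_nonneg
    have h2 := mul_nonneg (show 0 ≤ a / h by positivity) (hB x y)
    rw [sub_apply] at h2
    have h3 : ⟪ι (x - y), ι (x - y)⟫ = ⟪ι x - ι v, ι (x - y)⟫ - ⟪ι y - ι v, ι (x - y)⟫ := by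
      rw [← inner_sub_left, sub_sub_sub_cancel_right, ← map_sub]
    rw [h3] at h1
    linarith
  obtain ⟨x, hx⟩ := exists_inner_add_monotone_eq_zero hTh hTm
  refine ⟨x, (-h⁻¹) • (ι x - ι v), fun y => ?_, ?_⟩
  · have h1 := hx y
    rw [hTa] at h1
    rw [real_inner_smul_left, inner_add_left, real_inner_smul_left]
    have h2 : h * (⟪x, y⟫ + ((h ^ 2)⁻¹ * ⟪ι x - ι v, ι y⟫ + a / h * B x y + h⁻¹ * ⟪u, y⟫)) =
        h * ⟪x, y⟫ + h⁻¹ * ⟪ι x - ι v, ι y⟫ + a * B x y + ⟪u, y⟫ := by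
      field_simp
      ring
    rw [h1, mul_zero] at h2
    linarith
  · rw [neg_smul, smul_neg, smul_inv_smul₀ hh.ne']
    abel_nf

theorem exists_isScheme [CompleteSpace V] (hB : ∀ x y, 0 ≤ (B x - B y) (x - y))
    (hBh : Hemicontinuous B) {α : ℝ → ℝ} (hα : ∀ t, 0 ≤ t → 0 < α t) {u₀ v₀ : V} {f₀ : H}
    (h₀ : StateEq ι B (α 0) u₀ v₀ f₀) {h : ℝ} (hh : 0 < h) :
    ∃ u v f, IsScheme ι B α h u v f ∧ u 0 = u₀ ∧ v 0 = v₀ ∧ f 0 = f₀ := by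
  choose vs fs hs1 hs2 using fun (n : ℕ) (p : V × V × H) =>
    exists_euler_step (ι := ι) hB hBh hh (hα ((n + 1 : ℕ) * h) (by positivity)) p.1 p.2.1
  set z : ℕ → V × V × H := fun n => Nat.rec (u₀, v₀, f₀)
    (fun n p => (p.1 + h • vs n p, vs n p, fs n p)) n with hz
  refine ⟨fun n => (z n).1, fun n => (z n).2.1, fun n => (z n).2.2, ⟨?_, fun n => rfl,
    fun n => hs2 n (z n)⟩, rfl, rfl, rfl⟩
  rintro (_ | n)
  · change StateEq ι B (α ((0 : ℕ) * h)) u₀ v₀ f₀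
    simpa using h₀
  · exact hs1 n (z n)

/-- Pairing each step with its new value cancels the `A` terms and leaves `-2 h α ⟨B v, v⟩`, which
is nonpositive by monotonicity and `B 0 = 0`. -/
theorem IsScheme.energy_le (hB : ∀ x y, 0 ≤ (B x - B y) (x - y)) (hB0 : B 0 = 0) {α : ℝ → ℝ}
    (hα : ∀ t, 0 ≤ t → 0 < α t) {h : ℝ} (hh : 0 < h) {u v : ℕ → V} {f : ℕ → H}
    (hs : IsScheme ι B α h u v f) (n : ℕ) :
    ‖u n‖ ^ 2 + ‖ι (v n)‖ ^ 2 ≤ ‖u 0‖ ^ 2 + ‖ι (v 0)‖ ^ 2 := by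
  induction n with
  | zero => rfl
  | succ n ih =>
    refine le_trans ?_ ih
    have h1 := norm_sq_sub_norm_sq_le_two_inner (u (n + 1)) (u n)
    have h2 := norm_sq_sub_norm_sq_le_two_inner (ι (v (n + 1))) (ι (v n))
    have h3 : u (n + 1) - u n = h • v (n + 1) := by rw [hs.step_u]; abel
    have h4 : ι (v (n + 1)) - ι (v n) = -(h • f (n + 1)) := by rw [hs.step_v]; abel
    rw [h3, inner_smul_right] at h1
    rw [h4, inner_neg_right, inner_smul_right, real_inner_comm, hs.state] at h2
    have h5 := hB (v (n + 1)) 0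
    rw [hB0, sub_zero, sub_zero] at h5
    have h6 := mul_nonneg hh.le (mul_nonneg (hα ((n + 1 : ℕ) * h) (by positivity)).le h5)
    linarith

/-- Quantitative bounds on `[0, T]` for the coefficient `α` and for `γ = (1 / α)'`. -/
structure CoeffBound (α γ : ℝ → ℝ) (T C : ℝ) : Prop where
  one_le : 1 ≤ C
  pos : ∀ t ∈ Icc 0 T, 0 < α t
  le : ∀ t ∈ Icc 0 T, α t ≤ C
  inv_le : ∀ t ∈ Icc 0 T, (α t)⁻¹ ≤ C
  abs_deriv_le : ∀ t ∈ Icc 0 T, |γ t| ≤ C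
  lipschitz : ∀ s ∈ Icc 0 T, ∀ t ∈ Icc 0 T, |α t - α s| ≤ C * |t - s|
  lipschitz_inv : ∀ s ∈ Icc 0 T, ∀ t ∈ Icc 0 T, |(α t)⁻¹ - (α s)⁻¹| ≤ C * |t - s|
  lipschitz_deriv : ∀ s ∈ Icc 0 T, ∀ t ∈ Icc 0 T, |γ t - γ s| ≤ C * |t - s|
  taylor : ∀ s ∈ Icc 0 T, ∀ t ∈ Icc 0 T,
    |(α t)⁻¹ - (α s)⁻¹ - γ t * (t - s)| ≤ C * (t - s) ^ 2

/-- The squared norm of the time derivative of `(u / α, v)`, up to a factor `α` in the second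
component. -/
def rate (b c : ℝ) (u v : V) (f : H) : ℝ := ‖b • v + c • u‖ ^ 2 + ‖b • f‖ ^ 2

theorem rate_nonneg (b c : ℝ) (u v : V) (f : H) : 0 ≤ rate b c u v f := by
  unfold rate; positivity

theorem norm_le_of_rate {a c C : ℝ} (hC : 1 ≤ C) (ha : 0 < a) (haC : a ≤ C) (hc : |c| ≤ C)
    (u v : V) :
    ‖v‖ ≤ C * ‖a⁻¹ • v + c • u‖ + C ^ 2 * ‖u‖ := by
  have h1 : v = a • (a⁻¹ • v + c • u) - (a * c) • u := by
    rw [smul_add, smul_inv_smul₀ ha.ne', smul_smul]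
    abel
  have hC0 : 0 ≤ C := by linarith
  calc ‖v‖ = ‖a • (a⁻¹ • v + c • u) - (a * c) • u‖ := by rw [← h1]
    _ ≤ ‖a • (a⁻¹ • v + c • u)‖ + ‖(a * c) • u‖ := norm_sub_le _ _
    _ = a * ‖a⁻¹ • v + c • u‖ + (a * |c|) * ‖u‖ := by
      rw [norm_smul, norm_smul, Real.norm_of_nonneg ha.le, Real.norm_eq_abs, abs_mul,
        abs_of_pos ha]
    _ ≤ C * ‖a⁻¹ • v + c • u‖ + (C * C) * ‖u‖ := by gcongr
    _ = _ := by ring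

/-- After division by `a` and `a'`, both state equations carry `B` with coefficient `1`, so
monotonicity leaves no coefficient error. Such an error would be of order `1` after division by `h`,
too large to sum over `T / h` steps. What remains are commutator terms of order `h`, linear in `u`
and `v`. -/
theorem rate_sub_le (hB : ∀ x y, 0 ≤ (B x - B y) (x - y)) {a a' c c' C h : ℝ} {u v u' v' : V}
    {f f' : H} (hC : 1 ≤ C) (hh : 0 < h) (ha : 0 < a) (ha' : 0 < a')
    (hb' : a'⁻¹ ≤ C) (hc : |c| ≤ C) (hc' : |c'| ≤ C)
    (hbb : |a'⁻¹ - a⁻¹| ≤ C * h) (hcc : |c' - c| ≤ C * h)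
    (htay : |a'⁻¹ - a⁻¹ - c' * h| ≤ C * h ^ 2)
    (hs : StateEq ι B a u v f) (hs' : StateEq ι B a' u' v' f') (hu : u' = u + h • v')
    (hv : ι v' = ι v - h • f') :
    rate a'⁻¹ c' u' v' f' - rate a⁻¹ c u v f ≤ 4 * C ^ 2 * h * (‖u'‖ + ‖v'‖ + ‖v‖) ^ 2 := by
  set b := a⁻¹ with hb
  set b' := a'⁻¹ with hb'
  have hbpos : 0 < b' := inv_pos.2 ha'
  have hC0 : 0 ≤ C := by linarith
  set p := b • v + c • u with hp
  set p' := b' • v' + c' • u' with hp'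
  have hs1 : StateEq ι B 1 (b • u) v (b • f) := fun x => by
    rw [real_inner_smul_left, real_inner_smul_left, hs, hb]; field_simp
  have hs1' : StateEq ι B 1 (b' • u') v' (b' • f') := fun x => by
    rw [real_inner_smul_left, real_inner_smul_left, hs', hb']; field_simp
  have hm := hs1'.inner_sub_le hB zero_le_one hs1
  rw [sub_self, abs_zero, zero_mul, map_sub, hv, sub_sub_cancel_left] at hm
  -- The defects of two discrete product rules: `e` compares the increment of `u / α` with `h • p'`,
  -- and `r` compares `p' - p` with `b' • (v' - v)`. The Taylor bound on `1 / α` is what makes `e`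
  -- of order `h`.
  set e := (h⁻¹ * (b' - b - c' * h)) • u' - (b' - b) • v' with he
  set r := (b' - b) • v + (c' - c) • u' + (c * h) • v' with hr
  have hu0 : u = u' - h • v' := by rw [hu]; abel
  have hw : b' • u' - b • u = h • (p' + e) := by
    rw [he, hp', hu0]
    match_scalars <;> field_simp <;> ring
  have hq : b' • (v' - v) = p' - p - r := by
    rw [hp, hp', hr, hu0]
    match_scalars <;> ring
  have hmain : ⟪p' + e, p' - p - r⟫ + ⟪b' • f', b' • f' - b • f⟫ ≤ 0 := by
    rw [hw, real_inner_smul_left, inner_neg_right, inner_smul_right] at hm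
    have h1 : ⟪p' + e, v' - v⟫ + ⟪b' • f' - b • f, f'⟫ ≤ 0 := by
      by_contra hcon
      push Not at hcon
      nlinarith
    rw [← hq, inner_smul_right, real_inner_smul_left, real_inner_comm _ f', ← mul_add]
    exact mul_nonpos_of_nonneg_of_nonpos hbpos.le h1
  set S := ‖u'‖ + ‖v'‖ + ‖v‖ with hS
  have hS0 : 0 ≤ S := by positivity
  have hen : ‖e‖ ≤ C * h * S := by
    have h1 : |h⁻¹ * (b' - b - c' * h)| ≤ C * h := by
      rw [abs_mul, abs_of_pos (inv_pos.2 hh)]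
      calc h⁻¹ * |b' - b - c' * h| ≤ h⁻¹ * (C * h ^ 2) := by gcongr
        _ = C * h := by field_simp
    calc ‖e‖ ≤ |h⁻¹ * (b' - b - c' * h)| * ‖u'‖ + |b' - b| * ‖v'‖ := by
          refine (norm_sub_le _ _).trans_eq ?_
          rw [norm_smul, norm_smul, Real.norm_eq_abs, Real.norm_eq_abs]
      _ ≤ C * h * ‖u'‖ + C * h * ‖v'‖ := by gcongr
      _ ≤ C * h * S := by
          rw [← mul_add]
          gcongr
          linarith [norm_nonneg v]
  have hrn : ‖r‖ ≤ C * h * S := by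
    calc ‖r‖ ≤ |b' - b| * ‖v‖ + |c' - c| * ‖u'‖ + |c * h| * ‖v'‖ := by
          refine (norm_add₃_le).trans_eq ?_
          simp only [norm_smul, Real.norm_eq_abs]
      _ ≤ C * h * ‖v‖ + C * h * ‖u'‖ + C * h * ‖v'‖ := by
          rw [abs_mul c, abs_of_pos hh]
          gcongr
      _ = C * h * S := by rw [hS]; ring
  have hpn : ‖p'‖ ≤ C * S := by
    calc ‖p'‖ ≤ b' * ‖v'‖ + |c'| * ‖u'‖ := by
          refine (norm_add_le _ _).trans_eq ?_
          rw [norm_smul, norm_smul, Real.norm_eq_abs, Real.norm_eq_abs, abs_of_pos hbpos]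
      _ ≤ C * ‖v'‖ + C * ‖u'‖ := by gcongr
      _ ≤ C * S := by
          rw [← mul_add]
          gcongr
          linarith [norm_nonneg v]
  have hqn : ‖b' • (v' - v)‖ ≤ C * S := by
    rw [norm_smul, Real.norm_of_nonneg hbpos.le]
    gcongr
    exact (norm_sub_le _ _).trans (by linarith [norm_nonneg u'])
  have hdiff : ⟪p', p' - p⟫ + ⟪b' • f', b' • f' - b • f⟫ ≤ 2 * C ^ 2 * h * S ^ 2 := by
    have h1 : ⟪p' + e, p' - p - r⟫ = ⟪p', p' - p⟫ - ⟪p', r⟫ + ⟪e, b' • (v' - v)⟫ := by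
      rw [hq, inner_add_left, inner_sub_right p']
    have h2 : ⟪p', r⟫ ≤ (C * S) * (C * h * S) :=
      (real_inner_le_norm _ _).trans (mul_le_mul hpn hrn (norm_nonneg _) (by positivity))
    have h3 : -⟪e, b' • (v' - v)⟫ ≤ (C * h * S) * (C * S) :=
      (neg_le_abs _).trans ((abs_real_inner_le_norm _ _).trans
        (mul_le_mul hen hqn (norm_nonneg _) (by positivity)))
    rw [h1] at hmain
    nlinarith
  have hY : rate b' c' u' v' f' - rate b c u v f ≤
      2 * (⟪p', p' - p⟫ + ⟪b' • f', b' • f' - b • f⟫) := by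
    have h1 := norm_sq_sub_norm_sq_le_two_inner p' p
    have h2 := norm_sq_sub_norm_sq_le_two_inner (b' • f') (b • f)
    simp only [rate]
    linarith
  linarith

theorem sq_add_norm_le_rate {a a' c c' C K : ℝ} {u v u' v' : V} (f f' : H) (hC : 1 ≤ C)
    (ha : 0 < a) (ha' : 0 < a') (haC : a ≤ C) (haC' : a' ≤ C) (hc : |c| ≤ C) (hc' : |c'| ≤ C)
    (hK : ‖u‖ ^ 2 ≤ K) (hK' : ‖u'‖ ^ 2 ≤ K) :
    (‖u'‖ + ‖v'‖ + ‖v‖) ^ 2 ≤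
      16 * C ^ 4 * ((rate a'⁻¹ c' u' v' f' + K) + (rate a⁻¹ c u v f + K)) := by
  have h1 := norm_le_of_rate hC ha haC hc u v
  have h2 := norm_le_of_rate hC ha' haC' hc' u' v'
  have e1 : ‖a'⁻¹ • v' + c' • u'‖ ^ 2 ≤ rate a'⁻¹ c' u' v' f' :=
    le_add_of_nonneg_right (sq_nonneg _)
  have e2 : ‖a⁻¹ • v + c • u‖ ^ 2 ≤ rate a⁻¹ c u v f := le_add_of_nonneg_right (sq_nonneg _)
  generalize rate a'⁻¹ c' u' v' f' = Y' at *
  generalize rate a⁻¹ c u v f = Y at *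
  generalize ‖a'⁻¹ • v' + c' • u'‖ = P' at *
  have hP : 0 ≤ ‖a⁻¹ • v + c • u‖ := norm_nonneg _
  generalize ‖a⁻¹ • v + c • u‖ = P at *
  have hu := norm_nonneg u
  have hu' := norm_nonneg u'
  have hv := norm_nonneg v
  have hv' := norm_nonneg v'
  generalize ‖u‖ = x at *
  generalize ‖u'‖ = x' at *
  have hCC : C ≤ C ^ 2 := by nlinarith
  have hC1 : 1 ≤ C ^ 2 := by nlinarith
  have hP' : C * P' ≤ C ^ 2 * |P'| :=
    (mul_le_mul_of_nonneg_left (le_abs_self P') (by linarith)).trans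
      (mul_le_mul_of_nonneg_right hCC (abs_nonneg _))
  have h3 : x' + ‖v'‖ + ‖v‖ ≤ 2 * C ^ 2 * (x' + x + |P'| + P) := by
    have i1 := mul_le_mul_of_nonneg_right hCC hP
    have i2 := mul_le_mul_of_nonneg_right hC1 hu'
    have i3 := mul_nonneg (sq_nonneg C) hu
    have i4 := mul_nonneg (sq_nonneg C) hP
    have i5 := mul_nonneg (sq_nonneg C) (abs_nonneg P')
    linarith
  have h4 : (x' + x + |P'| + P) ^ 2 ≤ 4 * ((Y' + K) + (Y + K)) := by
    rw [← sq_abs P'] at e1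
    linarith [sq_nonneg (x' - x), sq_nonneg (x' - |P'|), sq_nonneg (x' - P),
      sq_nonneg (x - |P'|), sq_nonneg (x - P), sq_nonneg (|P'| - P)]
  calc (x' + ‖v'‖ + ‖v‖) ^ 2 ≤ (2 * C ^ 2 * (x' + x + |P'| + P)) ^ 2 := by gcongr
    _ = 4 * C ^ 4 * (x' + x + |P'| + P) ^ 2 := by ring
    _ ≤ 4 * C ^ 4 * (4 * ((Y' + K) + (Y + K))) := by gcongr
    _ = _ := by ring

theorem rate_step_le (hB : ∀ x y, 0 ≤ (B x - B y) (x - y)) {a a' c c' C h K : ℝ} {u v u' v' : V}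
    {f f' : H} (hC : 1 ≤ C) (hh : 0 < h) (ha : 0 < a) (ha' : 0 < a') (haC : a ≤ C) (haC' : a' ≤ C)
    (hb' : a'⁻¹ ≤ C) (hc : |c| ≤ C) (hc' : |c'| ≤ C)
    (hbb : |a'⁻¹ - a⁻¹| ≤ C * h) (hcc : |c' - c| ≤ C * h)
    (htay : |a'⁻¹ - a⁻¹ - c' * h| ≤ C * h ^ 2)
    (hs : StateEq ι B a u v f) (hs' : StateEq ι B a' u' v' f') (hu : u' = u + h • v')
    (hv : ι v' = ι v - h • f') (hK : ‖u‖ ^ 2 ≤ K) (hK' : ‖u'‖ ^ 2 ≤ K) :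
    rate a'⁻¹ c' u' v' f' + K - (rate a⁻¹ c u v f + K) ≤
      64 * C ^ 6 * h * ((rate a'⁻¹ c' u' v' f' + K) + (rate a⁻¹ c u v f + K)) := by
  have h1 := rate_sub_le hB hC hh ha ha' hb' hc hc' hbb hcc htay hs hs' hu hv
  have h2 := sq_add_norm_le_rate (v := v) (v' := v') f f' hC ha ha' haC haC' hc hc' hK hK'
  have h3 : 0 ≤ 4 * C ^ 2 * h := by positivity
  calc _ = rate a'⁻¹ c' u' v' f' - rate a⁻¹ c u v f := by ring
    _ ≤ 4 * C ^ 2 * h * (‖u'‖ + ‖v'‖ + ‖v‖) ^ 2 := h1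
    _ ≤ _ := mul_le_mul_of_nonneg_left h2 h3
    _ = _ := by ring

/-- One implicit Gronwall step: `(1 + k) / (1 - k) ≤ exp (3 k)`, because `1 / (1 - k) ≤ exp (2 k)`
for `k ≤ 1 / 2`. -/
theorem le_exp_mul_of_sub_le {x y k : ℝ} (hk0 : 0 ≤ k) (hk : k ≤ 1 / 2) (hx : 0 ≤ x)
    (h : y - x ≤ k * (y + x)) : y ≤ Real.exp (3 * k) * x := by
  have h1 : 1 + k ≤ Real.exp k := by linarith [Real.add_one_le_exp k]
  have h2 : 1 ≤ (1 - k) * Real.exp (2 * k) := by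
    have := Real.add_one_le_exp (2 * k)
    nlinarith
  have h3 : (1 - k) * y ≤ (1 + k) * x := by linarith
  have h4 : Real.exp (3 * k) = Real.exp k * Real.exp (2 * k) := by
    rw [← Real.exp_add]; ring_nf
  have h5 : (1 - k) * y ≤ (1 - k) * (Real.exp (3 * k) * x) := by
    calc (1 - k) * y ≤ (1 + k) * x := h3
      _ ≤ Real.exp k * x := by gcongr
      _ ≤ Real.exp k * x * ((1 - k) * Real.exp (2 * k)) :=
        le_mul_of_one_le_right (by positivity) h2
      _ = _ := by rw [h4]; ring
  exact le_of_mul_le_mul_left h5 (by linarith)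

/-- Discrete Gronwall with `k = 64 C⁶ h` at each step, whence the exponent `192 C⁶ = 3 · 64 C⁶`.
Adding `K` absorbs `‖u‖²`, which `rate` alone does not control. -/
theorem IsScheme.rate_le (hB : ∀ x y, 0 ≤ (B x - B y) (x - y)) (hB0 : B 0 = 0) {α γ : ℝ → ℝ}
    (hα : ∀ t, 0 ≤ t → 0 < α t) {T C : ℝ} (hC : CoeffBound α γ T C) {h : ℝ} (hh : 0 < h)
    (hhC : 64 * C ^ 6 * h ≤ 1 / 2) {u v : ℕ → V} {f : ℕ → H} {K : ℝ}
    (hs : IsScheme ι B α h u v f) (hK : ‖u 0‖ ^ 2 + ‖ι (v 0)‖ ^ 2 ≤ K) (n : ℕ) (hn : n * h ≤ T) :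
    rate (α (n * h))⁻¹ (γ (n * h)) (u n) (v n) (f n) + K ≤
      Real.exp (192 * C ^ 6 * (n * h)) * (rate (α 0)⁻¹ (γ 0) (u 0) (v 0) (f 0) + K) := by
  induction n with
  | zero => simp
  | succ n ih =>
    have hn0 : (n : ℝ) * h ∈ Icc 0 T := ⟨by positivity, by push_cast at hn; nlinarith⟩
    have hn1 : ((n + 1 : ℕ) : ℝ) * h ∈ Icc 0 T := ⟨by positivity, hn⟩
    have hd : ((n + 1 : ℕ) : ℝ) * h - n * h = h := by push_cast; ring
    have hKn : ∀ m, ‖u m‖ ^ 2 ≤ K := fun m =>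
      (le_add_of_nonneg_right (sq_nonneg _)).trans ((hs.energy_le hB hB0 hα hh m).trans hK)
    have e1 := hC.lipschitz_inv _ hn0 _ hn1
    have e2 := hC.lipschitz_deriv _ hn0 _ hn1
    have e3 := hC.taylor _ hn0 _ hn1
    rw [hd] at e1 e2 e3
    rw [abs_of_pos hh] at e1 e2
    have h1 := rate_step_le hB hC.one_le hh (hC.pos _ hn0) (hC.pos _ hn1) (hC.le _ hn0)
      (hC.le _ hn1) (hC.inv_le _ hn1) (hC.abs_deriv_le _ hn0) (hC.abs_deriv_le _ hn1)
      e1 e2 e3 (hs.state n) (hs.state (n + 1)) (hs.step_u n) (hs.step_v n) (hKn n) (hKn (n + 1))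
    have hK0 : 0 ≤ K := (sq_nonneg _).trans (hKn 0)
    have hC0 : 0 ≤ C := zero_le_one.trans hC.one_le
    have h2 := le_exp_mul_of_sub_le (by positivity) hhC (add_nonneg (rate_nonneg _ _ _ _ _) hK0) h1
    refine h2.trans ((mul_le_mul_of_nonneg_left (ih hn0.2) (Real.exp_pos _).le).trans_eq ?_)
    rw [← mul_assoc, ← Real.exp_add]
    congr 2
    push_cast
    ring

theorem norm_le_of_rate_le {α γ : ℝ → ℝ} {T C t : ℝ} (hC : CoeffBound α γ T C) (ht : t ∈ Icc 0 T)
    {u v : V} {f : H} {M : ℝ} (h : rate (α t)⁻¹ (γ t) u v f ≤ M ^ 2) (hu : ‖u‖ ≤ M) :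
    ‖v‖ ≤ 2 * C ^ 2 * M ∧ ‖f‖ ≤ 2 * C ^ 2 * M := by
  have h1 := hC.one_le
  have hM : 0 ≤ M := (norm_nonneg _).trans hu
  have hCC : C ≤ C ^ 2 := by nlinarith
  unfold rate at h
  constructor
  · have h2 := norm_le_of_rate h1 (hC.pos t ht) (hC.le t ht) (hC.abs_deriv_le t ht) u v
    have h3 : ‖(α t)⁻¹ • v + γ t • u‖ ≤ M :=
      abs_le_of_sq_le_sq' (by nlinarith [sq_nonneg ‖(α t)⁻¹ • f‖]) hM |>.2
    calc ‖v‖ ≤ C * M + C ^ 2 * M := by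
          refine h2.trans ?_
          gcongr
      _ ≤ 2 * C ^ 2 * M := by nlinarith
  · have h3 : ‖(α t)⁻¹ • f‖ ≤ M :=
      abs_le_of_sq_le_sq' (by nlinarith [sq_nonneg ‖(α t)⁻¹ • v + γ t • u‖]) hM |>.2
    have h4 : f = α t • (α t)⁻¹ • f := (smul_inv_smul₀ (hC.pos t ht).ne' _).symm
    calc ‖f‖ = α t * ‖(α t)⁻¹ • f‖ := by
          rw [← Real.norm_of_nonneg (hC.pos t ht).le, ← norm_smul, Real.norm_of_nonneg
            (hC.pos t ht).le, ← h4]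
      _ ≤ C * M := mul_le_mul (hC.le t ht) h3 (norm_nonneg _) (by linarith)
      _ ≤ 2 * C ^ 2 * M := by nlinarith

/-- Halving the step of the scheme changes the result by `O(√h)`. -/
theorem IsScheme.dist_half_le (hB : ∀ x y, 0 ≤ (B x - B y) (x - y)) {α γ : ℝ → ℝ} {T C L R : ℝ}
    (hC : CoeffBound α γ T C) {h : ℝ} (hh : 0 < h) {u v u' v' : ℕ → V} {f f' : ℕ → H}
    (hs : IsScheme ι B α h u v f) (hs' : IsScheme ι B α (h / 2) u' v' f')
    (hL : ∀ n : ℕ, n * h ≤ T → ‖v n‖ ≤ L ∧ ‖f n‖ ≤ L)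
    (hL' : ∀ n : ℕ, n * (h / 2) ≤ T → ‖v' n‖ ≤ L ∧ ‖f' n‖ ≤ L)
    (hR : ∀ x, ‖x‖ ≤ L → ‖B x‖ ≤ R) (hu0 : u 0 = u' 0) (hv0 : v 0 = v' 0) (n : ℕ)
    (hn : n * h ≤ T) :
    ‖u n - u' (2 * n)‖ ^ 2 + ‖ι (v n - v' (2 * n))‖ ^ 2 ≤
      n * h * ((C * R * L + 2 * L ^ 2) * h) := by
  induction n with
  | zero => simp [hu0, hv0]
  | succ n ih =>
    have hn1 : ((n + 1 : ℕ) : ℝ) * h ∈ Icc 0 T := ⟨by positivity, hn⟩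
    have hle : (n : ℝ) * h ≤ T := by push_cast at hn; nlinarith
    have hm1 : ((2 * n + 1 : ℕ) : ℝ) * (h / 2) ∈ Icc 0 T :=
      ⟨by positivity, by push_cast at hn ⊢; nlinarith⟩
    have hm2e : ((2 * n + 1 + 1 : ℕ) : ℝ) * (h / 2) = (n + 1 : ℕ) * h := by push_cast; ring
    have hm2 : ((2 * n + 1 + 1 : ℕ) : ℝ) * (h / 2) ≤ T := hm2e ▸ hn
    rw [show 2 * (n + 1) = 2 * n + 1 + 1 by ring]
    obtain ⟨a1, a2⟩ := hL _ hn
    obtain ⟨b1, b2⟩ := hL' _ hm1.2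
    obtain ⟨c1, c2⟩ := hL' _ hm2
    have hL0 : 0 ≤ L := (norm_nonneg _).trans a1
    have hR0 : 0 ≤ R := (norm_nonneg _).trans (hR _ a1)
    have hC0 : 0 ≤ C := zero_le_one.trans hC.one_le
    -- The coarse step is compared with both half steps. The second is at the same time, so its
    -- coefficient error vanishes; the first costs `O(h)`, and the factor `h` of the step makes this
    -- a summable `O(h²)`.
    have s1 := (hs.state (n + 1)).inner_sub_le hB (hC.pos _ hn1).le (hs'.state (2 * n + 1))
    have s2 := (hs.state (n + 1)).inner_sub_le hB (hC.pos _ hn1).le (hs'.state (2 * n + 1 + 1))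
    rw [hm2e, sub_self, abs_zero, zero_mul] at s2
    have hal : |α ((n + 1 : ℕ) * h) - α ((2 * n + 1 : ℕ) * (h / 2))| ≤ C * (h / 2) := by
      refine (hC.lipschitz _ hm1 _ hn1).trans_eq ?_
      rw [show ((n + 1 : ℕ) : ℝ) * h - (2 * n + 1 : ℕ) * (h / 2) = h / 2 by push_cast; ring,
        abs_of_pos (by positivity)]
    have s1' : |α ((n + 1 : ℕ) * h) - α ((2 * n + 1 : ℕ) * (h / 2))| *
        (‖B (v' (2 * n + 1))‖ * ‖v (n + 1) - v' (2 * n + 1)‖) ≤ C * (h / 2) * (R * (2 * L)) := by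
      gcongr
      · exact hR _ b1
      · exact (norm_sub_le _ _).trans (by linarith)
    have k1 := hs'.step_u (2 * n)
    have k2 := hs'.step_u (2 * n + 1)
    have k3 := hs'.step_v (2 * n)
    have k4 := hs'.step_v (2 * n + 1)
    set m := 2 * n + 1 with hm
    have e1 : u (n + 1) - u' (m + 1) - (u n - u' (2 * n)) =
        (h / 2) • ((v (n + 1) - v' m) + (v (n + 1) - v' (m + 1))) := by
      rw [hs.step_u, k2, k1]
      match_scalars <;> ring
    have e2 : ι (v (n + 1) - v' (m + 1)) - ι (v n - v' (2 * n)) =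
        -((h / 2) • ((f (n + 1) - f' m) + (f (n + 1) - f' (m + 1)))) := by
      rw [map_sub, map_sub, hs.step_v, k4, k3]
      match_scalars <;> ring
    have g1 := norm_sq_sub_norm_sq_le_two_inner (u (n + 1) - u' (m + 1)) (u n - u' (2 * n))
    have g2 := norm_sq_sub_norm_sq_le_two_inner (ι (v (n + 1) - v' (m + 1)))
      (ι (v n - v' (2 * n)))
    rw [e1, inner_smul_right, inner_add_right] at g1
    rw [e2, inner_neg_right, inner_smul_right, inner_add_right] at g2
    -- Monotonicity needs `u`, `v`, `f` at the same fine index, whereas the energy is taken at index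
    -- `m + 1`; shifting by one half step costs `O(h)`.
    have t1 : ⟪u (n + 1) - u' (m + 1), v (n + 1) - v' m⟫ ≤
        ⟪u (n + 1) - u' m, v (n + 1) - v' m⟫ + (h / 2) * L * (2 * L) := by
      have : u (n + 1) - u' (m + 1) = (u (n + 1) - u' m) - (h / 2) • v' (m + 1) := by
        rw [k2]; abel
      rw [this, inner_sub_left]
      have h1 : -⟪(h / 2) • v' (m + 1), v (n + 1) - v' m⟫ ≤ (h / 2) * L * (2 * L) := by
        refine (neg_le_abs _).trans ((abs_real_inner_le_norm _ _).trans ?_)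
        rw [norm_smul, Real.norm_of_nonneg (by positivity)]
        gcongr
        exact (norm_sub_le _ _).trans (by linarith)
      linarith
    have t2 : -⟪ι (v (n + 1) - v' (m + 1)), f (n + 1) - f' m⟫ ≤
        -⟪f (n + 1) - f' m, ι (v (n + 1) - v' m)⟫ + (h / 2) * L * (2 * L) := by
      have : ι (v (n + 1) - v' (m + 1)) = ι (v (n + 1) - v' m) + (h / 2) • f' (m + 1) := by
        rw [map_sub, map_sub, k4]; abel
      rw [this, inner_add_left, real_inner_comm (ι _)]
      have h1 : -⟪(h / 2) • f' (m + 1), f (n + 1) - f' m⟫ ≤ (h / 2) * L * (2 * L) := by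
        refine (neg_le_abs _).trans ((abs_real_inner_le_norm _ _).trans ?_)
        rw [norm_smul, Real.norm_of_nonneg (by positivity)]
        gcongr
        exact (norm_sub_le _ _).trans (by linarith)
      linarith
    rw [real_inner_comm (f (n + 1) - f' (m + 1))] at g2
    have hsum : ⟪u (n + 1) - u' (m + 1), v (n + 1) - v' m⟫ +
        ⟪u (n + 1) - u' (m + 1), v (n + 1) - v' (m + 1)⟫ -
        ⟪ι (v (n + 1) - v' (m + 1)), f (n + 1) - f' m⟫ -
        ⟪f (n + 1) - f' (m + 1), ι (v (n + 1) - v' (m + 1))⟫ ≤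
        (C * R * L + 2 * L ^ 2) * h := by nlinarith
    have hfin := mul_le_mul_of_nonneg_left hsum hh.le
    have ih' := ih hle
    push_cast
    nlinarith

end Scheme

/-! ### Limits of sequences on dyadic grids and differentiability of the limit. -/

section Dyadic

/-- The dyadic step `2⁻ᵏ`. -/
def dyadicStep (k : ℕ) : ℝ := (1 / 2) ^ k

/-- The index of the last grid point of step `2⁻ᵏ` before `t`. -/
def dyadicIndex (k : ℕ) (t : ℝ) : ℕ := ⌊t / dyadicStep k⌋₊

theorem dyadicStep_pos (k : ℕ) : 0 < dyadicStep k := by unfold dyadicStep; positivity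

theorem dyadicStep_succ (k : ℕ) : dyadicStep (k + 1) = dyadicStep k / 2 := by
  unfold dyadicStep; rw [pow_succ]; ring

theorem tendsto_dyadicStep : Tendsto dyadicStep atTop (𝓝 0) :=
  tendsto_pow_atTop_nhds_zero_of_lt_one (by norm_num) (by norm_num)

theorem dyadicIndex_mul_le (k : ℕ) {t : ℝ} (ht : 0 ≤ t) :
    dyadicIndex k t * dyadicStep k ≤ t :=
  (le_div_iff₀ (dyadicStep_pos k)).1 (Nat.floor_le (div_nonneg ht (dyadicStep_pos k).le))

theorem lt_dyadicIndex_add_one_mul (k : ℕ) (t : ℝ) :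
    t < (dyadicIndex k t + 1) * dyadicStep k :=
  (div_lt_iff₀ (dyadicStep_pos k)).1 (Nat.lt_floor_add_one _)

theorem dyadicIndex_natCast_mul (k n : ℕ) : dyadicIndex k (n * dyadicStep k) = n := by
  unfold dyadicIndex
  rw [mul_div_cancel_right₀ _ (dyadicStep_pos k).ne', Nat.floor_natCast]

theorem dyadicIndex_zero (k : ℕ) : dyadicIndex k 0 = 0 := by simp [dyadicIndex]

theorem dyadicIndex_mono (k : ℕ) : Monotone (dyadicIndex k) := fun _ _ h =>
  Nat.floor_mono (div_le_div_of_nonneg_right h (dyadicStep_pos k).le)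

theorem dyadicIndex_succ (k : ℕ) {t : ℝ} (ht : 0 ≤ t) :
    dyadicIndex (k + 1) t = 2 * dyadicIndex k t ∨
      dyadicIndex (k + 1) t = 2 * dyadicIndex k t + 1 := by
  have h1 := dyadicIndex_mul_le k ht
  have h2 := lt_dyadicIndex_add_one_mul k t
  have h3 := dyadicIndex_mul_le (k + 1) ht
  have h4 := lt_dyadicIndex_add_one_mul (k + 1) t
  rw [dyadicStep_succ] at h3 h4
  have hp := dyadicStep_pos k
  set a := dyadicIndex k t
  set b := dyadicIndex (k + 1) t
  have h5 : (b : ℝ) < 2 * a + 2 := by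
    by_contra hcon
    push Not at hcon
    nlinarith
  have h6 : (2 * a : ℝ) < b + 1 := by
    by_contra hcon
    push Not at hcon
    nlinarith
  have h5' : b < 2 * a + 2 := by exact_mod_cast h5
  have h6' : 2 * a < b + 1 := by exact_mod_cast h6
  omega

theorem tendsto_dyadicIndex_mul (s : ℝ) :
    Tendsto (fun p : ℕ × ℝ => dyadicIndex p.1 p.2 * dyadicStep p.1)
      (atTop ×ˢ 𝓝[Ici 0] s) (𝓝 s) := by
  have h1 : Tendsto (fun p : ℕ × ℝ => p.2) (atTop ×ˢ 𝓝[Ici 0] s) (𝓝 s) :=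
    tendsto_snd.mono_right nhdsWithin_le_nhds
  have h2 : Tendsto (fun p : ℕ × ℝ => p.2 - dyadicStep p.1) (atTop ×ˢ 𝓝[Ici 0] s) (𝓝 s) := by
    simpa using h1.sub (tendsto_dyadicStep.comp tendsto_fst)
  have h3 : ∀ᶠ p : ℕ × ℝ in atTop ×ˢ 𝓝[Ici 0] s, p.2 ∈ Ici (0 : ℝ) :=
    tendsto_snd.eventually self_mem_nhdsWithin
  refine tendsto_of_tendsto_of_tendsto_of_le_of_le' h2 h1 ?_ ?_
  · filter_upwards with p
    have := lt_dyadicIndex_add_one_mul p.1 p.2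
    linarith
  · filter_upwards [h3] with p hp using dyadicIndex_mul_le _ hp

theorem tendsto_atTop_prod_nhdsWithin {E : Type*} [TopologicalSpace E] {X : ℕ × ℝ → E} {s : ℝ}
    {x : E} (hs : 0 ≤ s) (h : Tendsto X (atTop ×ˢ 𝓝[Ici 0] s) (𝓝 x)) :
    Tendsto (fun k => X (k, s)) atTop (𝓝 x) :=
  h.comp (tendsto_id.prodMk (tendsto_const_pure.mono_right (pure_le_nhdsWithin (mem_Ici.2 hs))))

variable {E : Type*} [NormedAddCommGroup E]

theorem norm_sub_le_of_step_le {x : ℕ → E} {d : ℝ} {a b : ℕ} (hab : a ≤ b)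
    (h : ∀ n, a ≤ n → n + 1 ≤ b → ‖x (n + 1) - x n‖ ≤ d) : ‖x b - x a‖ ≤ (b - a : ℝ) * d := by
  induction b, hab using Nat.le_induction with
  | base => simp
  | succ n hn ih =>
    have h1 := ih fun m hm hmn => h m hm (hmn.trans n.le_succ)
    have h2 := h n hn le_rfl
    calc ‖x (n + 1) - x a‖ = ‖(x (n + 1) - x n) + (x n - x a)‖ := by rw [sub_add_sub_cancel]
      _ ≤ d + (n - a : ℝ) * d := (norm_add_le _ _).trans (add_le_add h2 h1)
      _ = _ := by push_cast; ring

/-- Limit of sequences on dyadic grids with Lipschitz bounds and summable refinement error. -/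
theorem exists_dyadic_limit [CompleteSpace E] {X : ℕ → ℕ → E} {r : ℝ} (hr0 : 0 ≤ r) (hr : r < 1)
    (hX : ∀ T : ℝ, 0 < T → ∃ (k₀ : ℕ) (M : ℝ), 0 ≤ M ∧ ∀ k ≥ k₀, ∀ n : ℕ,
      ((n + 1 : ℕ) * dyadicStep k ≤ T → ‖X k (n + 1) - X k n‖ ≤ M * dyadicStep k) ∧
      (n * dyadicStep k ≤ T →
        ‖X k n - X (k + 1) (2 * n)‖ ≤ M * r ^ k)) :
    ∃ x : ℝ → E, ContinuousOn x (Ici 0) ∧ ∀ s, 0 ≤ s →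
      Tendsto (fun p : ℕ × ℝ => X p.1 (dyadicIndex p.1 p.2)) (atTop ×ˢ 𝓝[Ici 0] s) (𝓝 (x s)) := by
  have hlip : ∀ T : ℝ, 0 < T → ∃ (k₀ : ℕ) (M : ℝ), 0 ≤ M ∧ ∀ k ≥ k₀, ∀ s ∈ Icc 0 T, ∀ t ∈ Icc 0 T,
      ‖X k (dyadicIndex k t) - X k (dyadicIndex k s)‖ ≤ M * (|t - s| + dyadicStep k) := by
    intro T hT
    obtain ⟨k₀, M, hM, hk⟩ := hX T hT
    refine ⟨k₀, M, hM, fun k hk' => ?_⟩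
    have key : ∀ s ∈ Icc 0 T, ∀ t ∈ Icc 0 T, s ≤ t →
        ‖X k (dyadicIndex k t) - X k (dyadicIndex k s)‖ ≤ M * (|t - s| + dyadicStep k) := by
      intro s hs t ht hst
      have h1 := norm_sub_le_of_step_le (x := X k) (d := M * dyadicStep k) (dyadicIndex_mono k hst)
        fun n _ hn => (hk k hk' n).1 (by
          refine (mul_le_mul_of_nonneg_right (Nat.cast_le.2 hn) (dyadicStep_pos k).le).trans ?_
          exact (dyadicIndex_mul_le k ht.1).trans ht.2)
      refine h1.trans ?_
      rw [abs_of_nonneg (sub_nonneg.2 hst), mul_left_comm]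
      refine mul_le_mul_of_nonneg_left ?_ hM
      have h2 := dyadicIndex_mul_le k ht.1
      have h3 := lt_dyadicIndex_add_one_mul k s
      linarith
    intro s hs t ht
    rcases le_total s t with h | h
    · exact key s hs t ht h
    · rw [norm_sub_rev, abs_sub_comm]
      exact key t ht s hs h
  have hlim : ∀ s : ℝ, ∃ x, 0 ≤ s → Tendsto (fun k => X k (dyadicIndex k s)) atTop (𝓝 x) := by
    intro s
    by_cases hs : 0 ≤ s
    swap
    · exact ⟨0, fun h => absurd h hs⟩
    obtain ⟨k₀, M, hM, hk⟩ := hX (s + 1) (by linarith)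
    have hle1 : ∀ k ≥ k₀, ‖X k (dyadicIndex k s) - X (k + 1) (dyadicIndex (k + 1) s)‖ ≤
        M * r ^ k + M * (1 / 2) ^ k := by
      intro k hkk
      have hn := dyadicIndex_mul_le k hs
      have h1 := (hk k hkk (dyadicIndex k s)).2 (by linarith)
      have hstep : (0 : ℝ) ≤ M * (1 / 2) ^ k := by positivity
      -- The fine grid point before `s` is either the coarse one or one fine step later; the extra
      -- step costs `M * dyadicStep (k + 1)`.
      rcases dyadicIndex_succ k hs with h | h
      · rw [h]; linarith
      · have h2 := (hk (k + 1) (by omega) (2 * dyadicIndex k s)).1 (by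
          rw [← h]
          linarith [dyadicIndex_mul_le (k + 1) hs])
        rw [h]
        have h3 : M * dyadicStep (k + 1) ≤ M * (1 / 2) ^ k := by
          rw [dyadicStep_succ]
          have := dyadicStep_pos k
          refine mul_le_mul_of_nonneg_left ?_ hM
          unfold dyadicStep at *
          linarith
        calc _ = ‖(X k (dyadicIndex k s) - X (k + 1) (2 * dyadicIndex k s)) -
              (X (k + 1) (2 * dyadicIndex k s + 1) - X (k + 1) (2 * dyadicIndex k s))‖ := by
              congr 1; abel
          _ ≤ _ := (norm_sub_le _ _).trans (by linarith)
    set ρ := max r (1 / 2) with hρ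
    have hρ1 : ρ < 1 := max_lt hr (by norm_num)
    have hcau : CauchySeq fun k => X (k + k₀) (dyadicIndex (k + k₀) s) := by
      refine cauchySeq_of_le_geometric ρ (2 * M * ρ ^ k₀) hρ1 fun k => ?_
      rw [dist_eq_norm, show k + 1 + k₀ = k + k₀ + 1 by ring]
      refine (hle1 (k + k₀) (by omega)).trans ?_
      have h1 : r ^ (k + k₀) ≤ ρ ^ (k + k₀) := pow_le_pow_left₀ hr0 (le_max_left _ _) _
      have h2 : (1 / 2 : ℝ) ^ (k + k₀) ≤ ρ ^ (k + k₀) :=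
        pow_le_pow_left₀ (by norm_num) (le_max_right _ _) _
      calc M * r ^ (k + k₀) + M * (1 / 2) ^ (k + k₀) ≤ M * ρ ^ (k + k₀) + M * ρ ^ (k + k₀) := by
            gcongr
        _ = _ := by rw [pow_add]; ring
    obtain ⟨x, hx⟩ := cauchySeq_tendsto_of_complete hcau
    exact ⟨x, fun _ => (tendsto_add_atTop_iff_nat k₀).1 hx⟩
  choose x hx using hlim
  refine ⟨x, ?_, fun s hs => ?_⟩
  · intro s hs
    have hs0 : (0 : ℝ) ≤ s := hs
    obtain ⟨k₀, M, hM, hk⟩ := hlip (s + 1) (by linarith)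
    have hle : ∀ t ∈ Icc 0 (s + 1), ‖x t - x s‖ ≤ M * |t - s| := by
      intro t ht
      have h1 := ((hx t ht.1).sub (hx s hs0)).norm
      have h2 := (tendsto_dyadicStep.const_add |t - s|).const_mul M
      rw [add_zero] at h2
      refine le_of_tendsto_of_tendsto h1 h2 ?_
      filter_upwards [eventually_ge_atTop k₀] with k hkk
      exact hk k hkk s ⟨hs0, by linarith⟩ t ht
    refine tendsto_iff_norm_sub_tendsto_zero.2 (squeeze_zero' (Eventually.of_forall fun _ =>
      norm_nonneg _) (g := fun t => M * |t - s|) ?_ ?_)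
    · filter_upwards [self_mem_nhdsWithin, mem_nhdsWithin_of_mem_nhds
        (Iic_mem_nhds (show s < s + 1 by linarith))] with t h1 h2 using hle t ⟨h1, h2⟩
    · have : Tendsto (fun t => M * |t - s|) (𝓝 s) (𝓝 (M * |s - s|)) :=
        Continuous.tendsto (by fun_prop) s
      rw [sub_self, abs_zero, mul_zero] at this
      exact this.mono_left nhdsWithin_le_nhds
  -- The limit is joint in the step and the time: Lipschitz bounds uniform in `k`, up to the grid
  -- size, replace the moving time by `s`.
  · obtain ⟨k₀, M, hM, hk⟩ := hlip (s + 1) (by linarith)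
    have h1 : Tendsto (fun p : ℕ × ℝ => X p.1 (dyadicIndex p.1 s)) (atTop ×ˢ 𝓝[Ici 0] s)
        (𝓝 (x s)) := (hx s hs).comp tendsto_fst
    have h2 : Tendsto (fun p : ℕ × ℝ => X p.1 (dyadicIndex p.1 p.2) - X p.1 (dyadicIndex p.1 s))
        (atTop ×ˢ 𝓝[Ici 0] s) (𝓝 0) := by
      refine squeeze_zero_norm' (a := fun p : ℕ × ℝ => M * (|p.2 - s| + dyadicStep p.1)) ?_ ?_
      · have e1 : ∀ᶠ p : ℕ × ℝ in atTop ×ˢ 𝓝[Ici 0] s, p.2 ∈ Icc 0 (s + 1) := by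
          refine tendsto_snd.eventually ?_
          filter_upwards [self_mem_nhdsWithin, mem_nhdsWithin_of_mem_nhds
            (Iic_mem_nhds (show s < s + 1 by linarith))] with t h1 h2 using ⟨h1, h2⟩
        filter_upwards [e1, tendsto_fst.eventually (eventually_ge_atTop k₀)] with p hp hp'
        exact hk p.1 hp' s ⟨hs, by linarith⟩ p.2 hp
      · have e1 : Tendsto (fun p : ℕ × ℝ => p.2) (atTop ×ˢ 𝓝[Ici 0] s) (𝓝 s) :=
          tendsto_snd.mono_right nhdsWithin_le_nhds
        have e2 := ((e1.sub_const s).abs.add (tendsto_dyadicStep.comp tendsto_fst)).const_mul M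
        simpa using e2
    simpa using h2.add h1

variable [NormedSpace ℝ E]

/-- The limit of an Euler scheme is differentiable where the right-hand sides converge. -/
theorem hasDerivWithinAt_dyadic_limit {X G : ℕ → ℕ → E}
    (hstep : ∀ k n, X k (n + 1) = X k n + dyadicStep k • G k (n + 1)) {x : ℝ → E}
    (hx : ∀ t, 0 ≤ t → Tendsto (fun k => X k (dyadicIndex k t)) atTop (𝓝 (x t))) {s : ℝ}
    (hs : 0 ≤ s) {g : E}
    (hG : Tendsto (fun p : ℕ × ℝ => G p.1 (dyadicIndex p.1 p.2)) (atTop ×ˢ 𝓝[Ici 0] s) (𝓝 g)) :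
    HasDerivWithinAt x g (Ici 0) s := by
  rw [hasDerivWithinAt_iff_isLittleO, Asymptotics.isLittleO_iff]
  intro c hc
  have h1 := hG.eventually (Metric.closedBall_mem_nhds g hc)
  obtain ⟨P, hP, Q, hQ, hPQ⟩ := eventually_prod_iff.1 h1
  obtain ⟨k₀, hk₀⟩ := eventually_atTop.1 hP
  rw [eventually_nhdsWithin_iff, Metric.eventually_nhds_iff] at hQ
  obtain ⟨δ, hδ, hQ⟩ := hQ
  have key : ∀ a b, 0 ≤ a → a ≤ b → dist a s < δ → dist b s < δ →
      ‖x b - x a - (b - a) • g‖ ≤ c * (b - a) := by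
    intro a b ha hab hda hdb
    have hb := ha.trans hab
    have hidx : ∀ t, 0 ≤ t → Tendsto (fun k => dyadicIndex k t * dyadicStep k) atTop (𝓝 t) :=
      fun t ht => tendsto_atTop_prod_nhdsWithin ht (tendsto_dyadicIndex_mul t)
    refine le_of_tendsto_of_tendsto
      (((hx b hb).sub (hx a ha)).sub (((hidx b hb).sub (hidx a ha)).smul_const g)).norm
      (((hidx b hb).sub (hidx a ha)).const_mul c) ?_
    filter_upwards [eventually_ge_atTop k₀] with k hk
    -- Subtracting the linear function of slope `g` leaves increments `dyadicStep k • (G k (n + 1) -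
    -- g)`. The new grid points lie in `[a, b]`, where the joint limit makes `G` close to `g`.
    have h2 := norm_sub_le_of_step_le (x := fun n => X k n - (n * dyadicStep k) • g)
      (d := c * dyadicStep k) (dyadicIndex_mono k hab) fun n hn hn' => by
        have hmem : a ≤ (n + 1 : ℕ) * dyadicStep k ∧ (n + 1 : ℕ) * dyadicStep k ≤ b := by
          have hp := (dyadicStep_pos k).le
          constructor
          · refine (lt_dyadicIndex_add_one_mul k a).le.trans ?_
            refine mul_le_mul_of_nonneg_right ?_ hp
            exact_mod_cast Nat.succ_le_succ hn
          · exact (mul_le_mul_of_nonneg_right (Nat.cast_le.2 hn') hp).trans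
              (dyadicIndex_mul_le k hb)
        have h3 := hPQ (hk₀ k hk) (hQ (y := (n + 1 : ℕ) * dyadicStep k) (by
          rw [Real.dist_eq, abs_lt] at hda hdb ⊢
          constructor <;> linarith [hmem.1, hmem.2]) (ha.trans hmem.1))
        simp only [dyadicIndex_natCast_mul, dist_eq_norm] at h3
        rw [hstep, show X k n + dyadicStep k • G k (n + 1) - (((n + 1 : ℕ) : ℝ) * dyadicStep k) • g -
          (X k n - ((n : ℝ) * dyadicStep k) • g) = dyadicStep k • (G k (n + 1) - g) by
            push_cast; match_scalars <;> ring, norm_smul,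
          Real.norm_of_nonneg (dyadicStep_pos k).le, mul_comm]
        exact mul_le_mul_of_nonneg_right h3 (dyadicStep_pos k).le
    refine (le_of_eq ?_).trans (h2.trans_eq ?_)
    · congr 1
      match_scalars <;> ring
    · ring
  filter_upwards [self_mem_nhdsWithin, mem_nhdsWithin_of_mem_nhds (Metric.ball_mem_nhds s hδ)]
    with t ht htd
  rcases le_total s t with h | h
  · have := key s t hs h (by simpa using hδ) htd
    rwa [Real.norm_of_nonneg (sub_nonneg.2 h)]
  · have := key t s ht h htd (by simpa using hδ)
    rw [Real.norm_eq_abs, abs_sub_comm, abs_of_nonneg (sub_nonneg.2 h)]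
    refine le_trans (le_of_eq ?_) this
    rw [← norm_neg]
    congr 1
    match_scalars <;> ring

end Dyadic

/-! ### Existence of a weak solution with the rate bound. -/

section Existence

variable {V H : Type*} [NormedAddCommGroup V] [InnerProductSpace ℝ V]
  [NormedAddCommGroup H] [InnerProductSpace ℝ H] {ι : V →L[ℝ] H} {B : V → StrongDual ℝ V}

/-- The triple `(u, v, f)` satisfies `u' = v`, `f = A u + α B v` for all `t ≥ 0`, and `v' = -f`
weakly in `H` for all `t ≥ 0` outside a countable set. -/
structure IsWeakSolution (ι : V →L[ℝ] H) (B : V → StrongDual ℝ V) (α : ℝ → ℝ)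
    (u v : ℝ → V) (f : ℝ → H) : Prop where
  cont_u : ContinuousOn u (Ici 0)
  cont_v : ContinuousOn (fun t => ι (v t)) (Ici 0)
  deriv_u : ∀ t, 0 ≤ t → HasDerivWithinAt (fun s => ι (u s)) (ι (v t)) (Ici 0) t
  state : ∀ t, 0 ≤ t → StateEq ι B (α t) (u t) (v t) (f t)
  deriv_v : ∃ S : Set ℝ, S.Countable ∧ ∀ t, 0 ≤ t → t ∉ S → ∀ φ,
    HasDerivWithinAt (fun s => ⟪ι (v s), φ⟫) (-⟪f t, φ⟫) (Ici 0) t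

section Coeff

variable {α γ : ℝ → ℝ}

theorem continuousOn_Ici_of_lipschitz {a : ℝ → ℝ}
    (h : ∀ T : ℝ, 0 < T → ∃ C : ℝ, ∀ s ∈ Icc 0 T, ∀ t ∈ Icc 0 T, |a t - a s| ≤ C * |t - s|) :
    ContinuousOn a (Ici 0) := by
  intro s hs
  have hs0 : (0 : ℝ) ≤ s := hs
  obtain ⟨C, hC⟩ := h (s + 1) (by linarith)
  refine tendsto_iff_norm_sub_tendsto_zero.2 (squeeze_zero' (Eventually.of_forall fun _ =>
    norm_nonneg _) (g := fun t => C * |t - s|) ?_ ?_)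
  · filter_upwards [self_mem_nhdsWithin, mem_nhdsWithin_of_mem_nhds
      (Iic_mem_nhds (show s < s + 1 by linarith))] with t h1 h2
    exact hC s ⟨hs0, by linarith⟩ t ⟨h1, h2⟩
  · have : Tendsto (fun t => C * |t - s|) (𝓝 s) (𝓝 (C * |s - s|)) :=
      Continuous.tendsto (by fun_prop) s
    rw [sub_self, abs_zero, mul_zero] at this
    exact this.mono_left nhdsWithin_le_nhds

variable (hα : ∀ T : ℝ, 0 < T → ∃ C, CoeffBound α γ T C)
include hα

theorem CoeffBound.pos_of_forall {t : ℝ} (ht : 0 ≤ t) : 0 < α t := by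
  obtain ⟨C, hC⟩ := hα (t + 1) (by linarith)
  exact hC.pos t ⟨ht, by linarith⟩

theorem CoeffBound.continuousOn : ContinuousOn α (Ici 0) :=
  continuousOn_Ici_of_lipschitz fun T hT => (hα T hT).imp fun _ h => h.lipschitz

theorem CoeffBound.continuousOn_deriv : ContinuousOn γ (Ici 0) :=
  continuousOn_Ici_of_lipschitz fun T hT => (hα T hT).imp fun _ h => h.lipschitz_deriv

end Coeff

theorem IsScheme.exists_bound (hB : ∀ x y, 0 ≤ (B x - B y) (x - y)) (hB0 : B 0 = 0) {α γ : ℝ → ℝ}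
    (hα : ∀ T : ℝ, 0 < T → ∃ C, CoeffBound α γ T C) {u v : ℕ → ℕ → V} {f : ℕ → ℕ → H} {u₀ v₀ : V}
    {f₀ : H} (hs : ∀ k, IsScheme ι B α (dyadicStep k) (u k) (v k) (f k)) (hu : ∀ k, u k 0 = u₀)
    (hv : ∀ k, v k 0 = v₀) (hf : ∀ k, f k 0 = f₀) {T : ℝ} (hT : 0 < T) :
    ∃ (k₀ : ℕ) (L : ℝ), 0 ≤ L ∧ ∀ k ≥ k₀, ∀ n : ℕ, n * dyadicStep k ≤ T →
      ‖v k n‖ ≤ L ∧ ‖f k n‖ ≤ L := by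
  have hαp : ∀ t, 0 ≤ t → 0 < α t := fun t ht => CoeffBound.pos_of_forall hα ht
  obtain ⟨C, hC⟩ := hα T hT
  have hsmall : ∀ᶠ k in atTop, 64 * C ^ 6 * dyadicStep k ≤ 1 / 2 := by
    have := tendsto_dyadicStep.const_mul (64 * C ^ 6)
    rw [mul_zero] at this
    exact (this.eventually (gt_mem_nhds (show (0 : ℝ) < 1 / 2 by norm_num))).mono fun _ h => h.le
  obtain ⟨k₀, hk₀⟩ := eventually_atTop.1 hsmall
  set K := ‖u₀‖ ^ 2 + ‖ι v₀‖ ^ 2 with hK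
  have hK0 : 0 ≤ K := by positivity
  set Q := Real.exp (192 * C ^ 6 * T) * (rate (α 0)⁻¹ (γ 0) u₀ v₀ f₀ + K) with hQ
  have hC0 : 0 ≤ C := zero_le_one.trans hC.one_le
  have hr0 : 0 ≤ rate (α 0)⁻¹ (γ 0) u₀ v₀ f₀ + K := add_nonneg (rate_nonneg _ _ _ _ _) hK0
  have hQ0 : 0 ≤ Q := by positivity
  have hKQ : K ≤ Q := by
    have h1 : 1 ≤ Real.exp (192 * C ^ 6 * T) := Real.one_le_exp (by positivity)
    have h2 := rate_nonneg (α 0)⁻¹ (γ 0) u₀ v₀ f₀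
    nlinarith
  refine ⟨k₀, 2 * C ^ 2 * √Q, by positivity, fun k hk n hn => ?_⟩
  have hp := dyadicStep_pos k
  have h1 := (hs k).rate_le hB hB0 hαp hC hp (hk₀ k hk) (K := K) (by rw [hu, hv]) n hn
  rw [hu, hv, hf] at h1
  refine norm_le_of_rate_le hC ⟨by positivity, hn⟩ (M := √Q) ?_ ?_ (u := u k n)
  · rw [Real.sq_sqrt hQ0]
    have : Real.exp (192 * C ^ 6 * (n * dyadicStep k)) * (rate (α 0)⁻¹ (γ 0) u₀ v₀ f₀ + K) ≤ Q := by
      rw [hQ]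
      gcongr
    linarith
  · refine Real.le_sqrt_of_sq_le (le_trans ?_ hKQ)
    have := (hs k).energy_le hB hB0 hαp hp n
    rw [hu, hv] at this
    exact (le_add_of_nonneg_right (sq_nonneg _)).trans this

theorem IsScheme.exists_refinement_bound (hB : ∀ x y, 0 ≤ (B x - B y) (x - y)) (hB0 : B 0 = 0)
    (hBb : ∀ L : ℝ, ∃ R, ∀ x, ‖x‖ ≤ L → ‖B x‖ ≤ R) {α γ : ℝ → ℝ}
    (hα : ∀ T : ℝ, 0 < T → ∃ C, CoeffBound α γ T C) {u v : ℕ → ℕ → V} {f : ℕ → ℕ → H} {u₀ v₀ : V}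
    {f₀ : H} (hs : ∀ k, IsScheme ι B α (dyadicStep k) (u k) (v k) (f k)) (hu : ∀ k, u k 0 = u₀)
    (hv : ∀ k, v k 0 = v₀) (hf : ∀ k, f k 0 = f₀) {T : ℝ} (hT : 0 < T) :
    ∃ (k₀ : ℕ) (M : ℝ), 0 ≤ M ∧ ∀ k ≥ k₀, ∀ n : ℕ,
      ((n + 1 : ℕ) * dyadicStep k ≤ T →
        ‖u k (n + 1) - u k n‖ ≤ M * dyadicStep k ∧
        ‖ι (v k (n + 1)) - ι (v k n)‖ ≤ M * dyadicStep k) ∧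
      (n * dyadicStep k ≤ T →
        ‖u k n - u (k + 1) (2 * n)‖ ≤ M * √(1 / 2) ^ k ∧
        ‖ι (v k n) - ι (v (k + 1) (2 * n))‖ ≤ M * √(1 / 2) ^ k) := by
  obtain ⟨k₀, L, hL0, hL⟩ := IsScheme.exists_bound hB hB0 hα hs hu hv hf hT
  obtain ⟨C, hC⟩ := hα T hT
  obtain ⟨R, hR⟩ := hBb L
  have hC0 : 0 ≤ C := zero_le_one.trans hC.one_le
  have hR0 : 0 ≤ R := (norm_nonneg _).trans (hR 0 (by simpa using hL0))
  set Q := T * (C * R * L + 2 * L ^ 2) with hQ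
  have hQ0 : 0 ≤ Q := by positivity
  refine ⟨k₀, L + √Q, by positivity, fun k hk n => ⟨fun hn => ?_, fun hn => ?_⟩⟩
  · have hp := dyadicStep_pos k
    obtain ⟨h1, h2⟩ := hL k hk (n + 1) hn
    have h3 : L * dyadicStep k ≤ (L + √Q) * dyadicStep k :=
      mul_le_mul_of_nonneg_right (le_add_of_nonneg_right (Real.sqrt_nonneg _)) hp.le
    constructor
    · rw [(hs k).step_u, add_sub_cancel_left, norm_smul, Real.norm_of_nonneg hp.le, mul_comm]
      exact (mul_le_mul_of_nonneg_right h1 hp.le).trans h3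
    · rw [(hs k).step_v, sub_sub_cancel_left, norm_neg, norm_smul, Real.norm_of_nonneg hp.le,
        mul_comm]
      exact (mul_le_mul_of_nonneg_right h2 hp.le).trans h3
  · have hp := dyadicStep_pos k
    have hs' := hs (k + 1)
    have hL' := hL (k + 1) (by omega)
    rw [dyadicStep_succ] at hs' hL'
    have h1 := (hs k).dist_half_le hB hC hp hs' (hL k hk) hL' hR (by rw [hu, hu])
      (by rw [hv, hv]) n hn
    have hr : (√(1 / 2) ^ k) ^ 2 = dyadicStep k := by
      rw [← pow_mul, mul_comm, pow_mul, Real.sq_sqrt (by norm_num), dyadicStep]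
    have h2 : n * dyadicStep k * ((C * R * L + 2 * L ^ 2) * dyadicStep k) ≤
        (√Q * √(1 / 2) ^ k) ^ 2 := by
      rw [mul_pow, Real.sq_sqrt hQ0, hr, hQ, mul_assoc T]
      gcongr
    have hnn : 0 ≤ √Q * √(1 / 2) ^ k := by positivity
    have h3 : √Q * √(1 / 2) ^ k ≤ (L + √Q) * √(1 / 2) ^ k := by
      gcongr
      linarith
    rw [← map_sub]
    exact ⟨(abs_le_of_sq_le_sq' (by nlinarith [sq_nonneg ‖ι (v k n - v (k + 1) (2 * n))‖])
      hnn).2.trans h3, (abs_le_of_sq_le_sq' (by nlinarith [sq_nonneg ‖u k n - u (k + 1) (2 * n)‖])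
      hnn).2.trans h3⟩

variable [CompleteSpace V] [CompleteSpace H]

/-- Beyond a solution, two facts are kept for later: the weak derivative exists at every time, which
strong regularity needs, and the rate bound holds, which uniqueness transfers to every other
solution. -/
theorem exists_isWeakSolution (hι : Function.Injective ι) (hιd : DenseRange ι)
    (hB : ∀ x y, 0 ≤ (B x - B y) (x - y)) (hBh : Hemicontinuous B) (hB0 : B 0 = 0)
    (hBb : ∀ L : ℝ, ∃ R, ∀ x, ‖x‖ ≤ L → ‖B x‖ ≤ R) {α γ : ℝ → ℝ}
    (hα : ∀ T : ℝ, 0 < T → ∃ C, CoeffBound α γ T C) {u₀ v₀ : V} {f₀ : H}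
    (h₀ : StateEq ι B (α 0) u₀ v₀ f₀) :
    ∃ u v f, IsWeakSolution ι B α u v f ∧ u 0 = u₀ ∧ v 0 = v₀ ∧ f 0 = f₀ ∧
      (∀ t, 0 ≤ t → ∀ φ, HasDerivWithinAt (fun s => ⟪ι (v s), φ⟫) (-⟪f t, φ⟫) (Ici 0) t) ∧
      ∀ T C K, CoeffBound α γ T C → ‖u₀‖ ^ 2 + ‖ι v₀‖ ^ 2 ≤ K → ∀ t ∈ Icc 0 T,
        rate (α t)⁻¹ (γ t) (u t) (v t) (f t) + K ≤
          Real.exp (192 * C ^ 6 * t) * (rate (α 0)⁻¹ (γ 0) u₀ v₀ f₀ + K) := by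
  have hαp : ∀ t, 0 ≤ t → 0 < α t := fun t ht => CoeffBound.pos_of_forall hα ht
  choose U W G hs hU0 hW0 hG0 using fun k =>
    exists_isScheme hB hBh hαp h₀ (dyadicStep_pos k)
  have href := fun T hT => IsScheme.exists_refinement_bound hB hB0 hBb hα hs hU0 hW0 hG0 (T := T) hT
  have hbd := fun T hT => IsScheme.exists_bound hB hB0 hα hs hU0 hW0 hG0 (T := T) hT
  have hr1 : √(1 / 2 : ℝ) < 1 := by
    rw [Real.sqrt_lt' one_pos]; norm_num
  obtain ⟨u, hucont, hu⟩ := exists_dyadic_limit (X := U) (Real.sqrt_nonneg (1 / 2)) hr1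
    fun T hT => by
      obtain ⟨k₀, M, hM, h⟩ := href T hT
      exact ⟨k₀, M, hM, fun k hk n => ⟨fun hn => ((h k hk n).1 hn).1,
        fun hn => ((h k hk n).2 hn).1⟩⟩
  obtain ⟨y, hycont, hy⟩ := exists_dyadic_limit (X := fun k n => ι (W k n))
    (Real.sqrt_nonneg (1 / 2)) hr1 fun T hT => by
      obtain ⟨k₀, M, hM, h⟩ := href T hT
      exact ⟨k₀, M, hM, fun k hk n => ⟨fun hn => ((h k hk n).1 hn).2,
        fun hn => ((h k hk n).2 hn).2⟩⟩
  have hgrid : ∀ {a : ℝ → ℝ}, ContinuousOn a (Ici 0) → ∀ s, 0 ≤ s →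
      Tendsto (fun p : ℕ × ℝ => a (dyadicIndex p.1 p.2 * dyadicStep p.1))
        (atTop ×ˢ 𝓝[Ici 0] s) (𝓝 (a s)) := by
    intro a ha s hs
    refine (ha s hs).tendsto.comp (tendsto_nhdsWithin_iff.2 ⟨tendsto_dyadicIndex_mul s, ?_⟩)
    exact Eventually.of_forall fun p =>
      mem_Ici.2 (mul_nonneg (Nat.cast_nonneg _) (dyadicStep_pos _).le)
  have hbound : ∀ s, 0 ≤ s → ∃ L, ∀ᶠ p : ℕ × ℝ in atTop ×ˢ 𝓝[Ici 0] s,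
      ‖W p.1 (dyadicIndex p.1 p.2)‖ ≤ L ∧ ‖G p.1 (dyadicIndex p.1 p.2)‖ ≤ L := by
    intro s hs
    obtain ⟨k₀, L, -, hL⟩ := hbd (s + 1) (by linarith)
    refine ⟨L, ?_⟩
    have e1 : ∀ᶠ p : ℕ × ℝ in atTop ×ˢ 𝓝[Ici 0] s, p.2 ∈ Icc 0 (s + 1) := by
      refine tendsto_snd.eventually ?_
      filter_upwards [self_mem_nhdsWithin, mem_nhdsWithin_of_mem_nhds
        (Iic_mem_nhds (show s < s + 1 by linarith))] with t h1 h2 using ⟨h1, h2⟩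
    filter_upwards [e1, tendsto_fst.eventually (eventually_ge_atTop k₀)] with p hp hp'
    exact hL p.1 hp' _ ((dyadicIndex_mul_le _ hp.1).trans hp.2)
  have hα_cont := CoeffBound.continuousOn hα
  have hγ_cont := CoeffBound.continuousOn_deriv hα
  have hne : ∀ s : ℝ, 0 ≤ s → (𝓝[Ici 0] s).NeBot := fun s hs =>
    (pure_neBot (a := s)).mono (pure_le_nhdsWithin (mem_Ici.2 hs))
  have hlim : ∀ s : ℝ, ∃ p : V × H, 0 ≤ s → ι p.1 = y s ∧ StateEq ι B (α s) (u s) p.1 p.2 := by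
    intro s
    by_cases hs0 : 0 ≤ s
    swap
    · exact ⟨0, fun h => absurd h hs0⟩
    obtain ⟨L, hL⟩ := hbound s hs0
    have := hne s hs0
    obtain ⟨v₁, f₁, h1, -, -, h4⟩ := StateEq.exists_limit (ι := ι) hB hBh
      (Eventually.of_forall fun p : ℕ × ℝ => (hs p.1).state (dyadicIndex p.1 p.2))
      (hL.mono fun _ h => h.1) (hL.mono fun _ h => h.2) (hu s hs0) (hy s hs0)
      (hgrid hα_cont s hs0) (hαp s hs0)
    exact ⟨(v₁, f₁), fun _ => ⟨h1, h4⟩⟩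
  choose p hp using hlim
  set v : ℝ → V := fun s => (p s).1 with hv
  set f : ℝ → H := fun s => (p s).2 with hf
  have hιv : ∀ s, 0 ≤ s → ι (v s) = y s := fun s hs => (hp s hs).1
  have hst : ∀ s, 0 ≤ s → StateEq ι B (α s) (u s) (v s) (f s) := fun s hs => (hp s hs).2
  have hweak : ∀ s, 0 ≤ s →
      WeaklyTendsto (fun p : ℕ × ℝ => W p.1 (dyadicIndex p.1 p.2)) (atTop ×ˢ 𝓝[Ici 0] s) (v s) ∧
      WeaklyTendsto (fun p : ℕ × ℝ => G p.1 (dyadicIndex p.1 p.2)) (atTop ×ˢ 𝓝[Ici 0] s) (f s) := by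
    intro s hs0
    obtain ⟨L, hL⟩ := hbound s hs0
    exact StateEq.weaklyTendsto hι hιd hB hBh
      (Eventually.of_forall fun p : ℕ × ℝ => (hs p.1).state (dyadicIndex p.1 p.2))
      (hL.mono fun _ h => h.1) (hL.mono fun _ h => h.2) (hu s hs0)
      (by rw [hιv s hs0]; exact hy s hs0) (hgrid hα_cont s hs0) (hαp s hs0) (hst s hs0)
  have hderiv : ∀ t, 0 ≤ t → ∀ φ,
      HasDerivWithinAt (fun s => ⟪ι (v s), φ⟫) (-⟪f t, φ⟫) (Ici 0) t := by
    intro t ht φ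
    have h1 : HasDerivWithinAt (fun s => ⟪y s, φ⟫) (-⟪f t, φ⟫) (Ici 0) t := by
      refine hasDerivWithinAt_dyadic_limit (X := fun k n => ⟪ι (W k n), φ⟫)
        (G := fun k n => -⟪G k n, φ⟫) (fun k n => ?_) (fun s hs0 => ?_) ht ((hweak t ht).2 φ).neg
      · rw [(hs k).step_v, inner_sub_left, real_inner_smul_left, smul_eq_mul]
        ring
      · exact (tendsto_atTop_prod_nhdsWithin hs0 (hy s hs0)).inner tendsto_const_nhds
    exact h1.congr (fun s hs0 => by rw [hιv s hs0]) (by rw [hιv t ht])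
  have hu0 : u 0 = u₀ := by
    refine tendsto_nhds_unique (tendsto_atTop_prod_nhdsWithin le_rfl (hu 0 le_rfl)) ?_
    simp only [dyadicIndex_zero, hU0]
    exact tendsto_const_nhds
  have hv0 : v 0 = v₀ := by
    refine hι ((hιv 0 le_rfl).trans ?_)
    refine tendsto_nhds_unique (tendsto_atTop_prod_nhdsWithin le_rfl (hy 0 le_rfl)) ?_
    simp only [dyadicIndex_zero, hW0]
    exact tendsto_const_nhds
  refine ⟨u, v, f, ⟨hucont, hycont.congr fun s hs0 => hιv s hs0, fun t ht => ?_, hst,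
    ∅, countable_empty, fun t ht _ => hderiv t ht⟩, hu0, hv0, ?_, hderiv, ?_⟩
  · refine hasDerivWithinAt_dyadic_limit (X := fun k n => ι (U k n)) (G := fun k n => ι (W k n))
      (fun k n => ?_) (fun s hs0 => ?_) ht (by rw [hιv t ht]; exact hy t ht)
    · rw [(hs k).step_u, map_add, map_smul]
    · exact (ι.continuous.tendsto _).comp (tendsto_atTop_prod_nhdsWithin hs0 (hu s hs0))
  · have := hst 0 le_rfl
    rw [hu0, hv0] at this
    exact this.unique hιd h₀
  · intro T C K hC hK t ht
    have hinv : Tendsto (fun p : ℕ × ℝ => (α (dyadicIndex p.1 p.2 * dyadicStep p.1))⁻¹)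
        (atTop ×ˢ 𝓝[Ici 0] t) (𝓝 (α t)⁻¹) := (hgrid hα_cont t ht.1).inv₀ (hαp t ht.1).ne'
    obtain ⟨hw1, hw2⟩ := hweak t ht.1
    -- Both vectors in `rate` converge weakly, so the discrete bound passes to the limit by lower
    -- semicontinuity of the joint norm.
    have hP := (hw1.smul hinv).add ((hu t ht.1).weaklyTendsto.smul (hgrid hγ_cont t ht.1))
    have hF := hw2.smul hinv
    have hE : Tendsto (fun p : ℕ × ℝ =>
        Real.exp (192 * C ^ 6 * (dyadicIndex p.1 p.2 * dyadicStep p.1)) *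
          (rate (α 0)⁻¹ (γ 0) u₀ v₀ f₀ + K) - K) (atTop ×ˢ 𝓝[Ici 0] t)
        (𝓝 (Real.exp (192 * C ^ 6 * t) * (rate (α 0)⁻¹ (γ 0) u₀ v₀ f₀ + K) - K)) :=
      (((Real.continuous_exp.tendsto _).comp
        ((tendsto_dyadicIndex_mul t).const_mul _)).mul_const _).sub_const _
    have hsmall : ∀ᶠ k in atTop, 64 * C ^ 6 * dyadicStep k ≤ 1 / 2 := by
      have := tendsto_dyadicStep.const_mul (64 * C ^ 6)
      rw [mul_zero] at this
      exact (this.eventually (gt_mem_nhds (show (0 : ℝ) < 1 / 2 by norm_num))).mono fun _ h => h.le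
    rw [← le_sub_iff_add_le]
    refine WeaklyTendsto.norm_sq_add_le
      (fun z => tendsto_atTop_prod_nhdsWithin ht.1 (hP z))
      (fun z => tendsto_atTop_prod_nhdsWithin ht.1 (hF z)) ?_
      (tendsto_atTop_prod_nhdsWithin ht.1 hE)
    filter_upwards [hsmall] with k hk
    have h1 := (hs k).rate_le hB hB0 hαp hC (dyadicStep_pos k) hk (K := K) (by rwa [hU0, hW0])
      (dyadicIndex k t) ((dyadicIndex_mul_le k ht.1).trans ht.2)
    rw [hU0, hW0, hG0] at h1
    exact le_sub_iff_add_le.2 h1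

end Existence

/-! ### Uniqueness for bounded velocities and propagation of the rate bound. -/

section Uniqueness

/-- A continuous function whose upper left Dini derivative is nonpositive outside a countable set
does not increase. -/
theorem le_of_left_dini_nonpos_off_countable {E : ℝ → ℝ} {a b : ℝ} (hab : a ≤ b)
    (hE : ContinuousOn E (Icc a b)) {S : Set ℝ} (hS : S.Countable)
    (h : ∀ t ∈ Ioc a b, t ∉ S → ∀ ε > 0, ∀ᶠ s in 𝓝[<] t, E t - E s ≤ ε * (t - s)) :
    E b ≤ E a := by
  by_contra hcon
  push Not at hcon
  have hab' : a < b := lt_of_le_of_ne hab fun e => by rw [e] at hcon; exact lt_irrefl _ hcon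
  set ε := (E b - E a) / (2 * (b - a)) with hε
  have hba : 0 < b - a := sub_pos.2 hab'
  have hε0 : 0 < ε := div_pos (sub_pos.2 hcon) (by positivity)
  set G : ℝ → ℝ := fun t => E t - ε * t with hG
  have hGc : ContinuousOn G (Icc a b) := hE.sub (by fun_prop)
  have hGab : G a < G b := by
    have : ε * (b - a) = (E b - E a) / 2 := by rw [hε]; field_simp
    simp only [hG]
    nlinarith
  -- Each intermediate value is reached for the first time at some `t`. If `t` were not in `S`, the
  -- Dini bound would give `G s ≥ c` just before `t`, hence an earlier crossing. So an interval
  -- would lie in the countable set `G '' S`.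
  have hsub : Ioo (G a) (G b) ⊆ G '' S := by
    intro c hc
    have hcl : IsClosed (Icc a b ∩ G ⁻¹' {c}) := hGc.preimage_isClosed_of_isClosed isClosed_Icc
      isClosed_singleton
    have hcp : IsCompact (Icc a b ∩ G ⁻¹' {c}) := isCompact_Icc.of_isClosed_subset hcl
      inter_subset_left
    obtain ⟨t₀, ht₀, hGt₀⟩ := intermediate_value_Icc hab hGc ⟨hc.1.le, hc.2.le⟩
    obtain ⟨t, ⟨htab, hGt⟩, hmin⟩ := hcp.exists_isLeast ⟨t₀, ht₀, hGt₀⟩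
    have hGt : G t = c := hGt
    have hat : a < t := lt_of_le_of_ne htab.1 fun e => by
      rw [← e] at hGt; exact absurd hGt hc.1.ne
    refine ⟨t, ?_, hGt⟩
    by_contra htS
    obtain ⟨s, hs, hsa⟩ := ((h t ⟨hat, htab.2⟩ htS ε hε0).and (Ioo_mem_nhdsLT hat)).exists
    have hGs : c ≤ G s := by
      simp only [hG] at hGt ⊢
      linarith
    obtain ⟨r, hr, hGr⟩ := intermediate_value_Icc hsa.1.le
      (hGc.mono (Icc_subset_Icc_right (hsa.2.le.trans htab.2))) ⟨hc.1.le, hGs⟩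
    have := hmin ⟨⟨hr.1, hr.2.trans (hsa.2.le.trans htab.2)⟩, hGr⟩
    linarith [hr.2, hsa.2]
  have hnull : volume (Ioo (G a) (G b)) = 0 := ((hS.image G).mono hsub).measure_zero _
  rw [Real.volume_Ioo, ENNReal.ofReal_eq_zero] at hnull
  linarith

variable {V H : Type*} [NormedAddCommGroup V] [InnerProductSpace ℝ V]
  [NormedAddCommGroup H] [InnerProductSpace ℝ H] {ι : V →L[ℝ] H} {B : V → StrongDual ℝ V}
  {α γ : ℝ → ℝ}

theorem CoeffBound.mono {T T' C : ℝ} (h : CoeffBound α γ T C) (hT : T' ≤ T) :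
    CoeffBound α γ T' C := by
  have hm : ∀ {t}, t ∈ Icc 0 T' → t ∈ Icc 0 T := fun ht => ⟨ht.1, ht.2.trans hT⟩
  exact ⟨h.one_le, fun t ht => h.pos _ (hm ht), fun t ht => h.le _ (hm ht),
    fun t ht => h.inv_le _ (hm ht), fun t ht => h.abs_deriv_le _ (hm ht),
    fun s hs t ht => h.lipschitz _ (hm hs) _ (hm ht),
    fun s hs t ht => h.lipschitz_inv _ (hm hs) _ (hm ht),
    fun s hs t ht => h.lipschitz_deriv _ (hm hs) _ (hm ht),
    fun s hs t ht => h.taylor _ (hm hs) _ (hm ht)⟩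

theorem CoeffBound.shift {T C a : ℝ} (ha : 0 ≤ a) (h : CoeffBound α γ (a + T) C) :
    CoeffBound (fun s => α (a + s)) (fun s => γ (a + s)) T C := by
  have hm : ∀ {t}, t ∈ Icc 0 T → a + t ∈ Icc 0 (a + T) := fun ht =>
    ⟨add_nonneg ha ht.1, by linarith [ht.2]⟩
  have hd : ∀ s t, t - s = (a + t) - (a + s) := fun s t => by ring
  refine ⟨h.one_le, fun t ht => h.pos _ (hm ht), fun t ht => h.le _ (hm ht),
    fun t ht => h.inv_le _ (hm ht), fun t ht => h.abs_deriv_le _ (hm ht),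
    fun s hs t ht => ?_, fun s hs t ht => ?_, fun s hs t ht => ?_, fun s hs t ht => ?_⟩
  · rw [hd s t]; exact h.lipschitz _ (hm hs) _ (hm ht)
  · rw [hd s t]; exact h.lipschitz_inv _ (hm hs) _ (hm ht)
  · rw [hd s t]; exact h.lipschitz_deriv _ (hm hs) _ (hm ht)
  · rw [hd s t]; exact h.taylor _ (hm hs) _ (hm ht)

theorem HasDerivWithinAt.shift_Ici {E : Type*} [NormedAddCommGroup E] [NormedSpace ℝ E]
    {x : ℝ → E} {g : E} {a t : ℝ} (ha : 0 ≤ a) (h : HasDerivWithinAt x g (Ici 0) (a + t)) :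
    HasDerivWithinAt (fun s => x (a + s)) g (Ici 0) t := by
  have h1 : HasDerivWithinAt (fun s => a + s) 1 (Ici 0) t :=
    ((hasDerivAt_id t).const_add a).hasDerivWithinAt
  have h2 := h.scomp t h1 (fun s hs => add_nonneg ha hs)
  rwa [one_smul] at h2

theorem IsWeakSolution.shift {u v : ℝ → V} {f : ℝ → H} (h : IsWeakSolution ι B α u v f) {a : ℝ}
    (ha : 0 ≤ a) : IsWeakSolution ι B (fun s => α (a + s)) (fun s => u (a + s))
      (fun s => v (a + s)) (fun s => f (a + s)) := by
  have hc : ContinuousOn (fun s => a + s) (Ici 0) := by fun_prop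
  have hm : MapsTo (fun s => a + s) (Ici (0 : ℝ)) (Ici 0) := fun s hs => add_nonneg ha hs
  obtain ⟨S, hS, hd⟩ := h.deriv_v
  exact ⟨h.cont_u.comp hc hm, h.cont_v.comp hc hm,
    fun t ht => (h.deriv_u (a + t) (add_nonneg ha ht)).shift_Ici ha,
    fun t ht => h.state (a + t) (add_nonneg ha ht),
    (fun s => a + s) ⁻¹' S, hS.preimage (add_right_injective a),
    fun t ht htS φ => (hd (a + t) (add_nonneg ha ht) htS φ).shift_Ici ha⟩

theorem tendsto_left_quotient {E : Type*} [NormedAddCommGroup E] [NormedSpace ℝ E]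
    {x : ℝ → E} {g : E} {t : ℝ} (ht : 0 < t) (h : HasDerivWithinAt x g (Ici 0) t) :
    Tendsto (fun s => (t - s)⁻¹ • (x t - x s)) (𝓝[<] t) (𝓝 g) := by
  have h1 := (hasDerivAt_iff_tendsto_slope.1 (h.hasDerivAt (Ici_mem_nhds ht))).mono_left
    (nhdsWithin_mono t fun s (hs : s < t) => hs.ne)
  refine h1.congr fun s => ?_
  rw [slope_def_module, ← neg_sub t s, ← neg_sub (x t) (x s), inv_neg, neg_smul, smul_neg, neg_neg]

variable [CompleteSpace V] [CompleteSpace H]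

/-- If `v = u'` is bounded in `V` then `u` is Lipschitz continuous in `V`. -/
theorem IsWeakSolution.norm_position_sub_le (hι : Function.Injective ι) {u v : ℝ → V} {f : ℝ → H}
    (h : IsWeakSolution ι B α u v f) {c b L : ℝ} (hc : 0 ≤ c) (hL0 : 0 ≤ L)
    (hL : ∀ t ∈ Icc c b, ‖v t‖ ≤ L) {s t : ℝ} (hs : s ∈ Icc c b) (ht : t ∈ Icc c b) :
    ‖u t - u s‖ ≤ L * |t - s| := by
  have key : ∀ z, |⟪u t - u s, z⟫| ≤ L * |t - s| * ‖z‖ := by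
    intro z
    refine (denseRange_adjoint hι).induction_on (p := fun z => |⟪u t - u s, z⟫| ≤
      L * |t - s| * ‖z‖) z (isClosed_le (by fun_prop) (by fun_prop)) fun w => ?_
    have h1 : ∀ r ∈ Icc c b, HasDerivWithinAt (fun r => ⟪ι (u r), w⟫) ⟪ι (v r), w⟫ (Icc c b) r := by
      intro r hr
      have := ((h.deriv_u r (hc.trans hr.1)).mono (fun x hx => hc.trans hx.1 : Icc c b ⊆ Ici 0)).inner
        ℝ (hasDerivWithinAt_const r (Icc c b) w)
      simpa using this
    have h2 := (convex_Icc c b).norm_image_sub_le_of_norm_hasDerivWithin_le (C := L * ‖ι.adjoint w‖)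
      h1 (fun r hr => by
        rw [← ContinuousLinearMap.adjoint_inner_right]
        exact (norm_inner_le_norm _ _).trans
          (mul_le_mul_of_nonneg_right (hL r hr) (norm_nonneg _))) hs ht
    rw [ContinuousLinearMap.adjoint_inner_right, map_sub, inner_sub_left]
    refine h2.trans_eq ?_
    rw [Real.norm_eq_abs]
    ring
  have h1 := key (u t - u s)
  rw [real_inner_self_eq_norm_sq, abs_of_nonneg (sq_nonneg _)] at h1
  by_contra hcon
  push Not at hcon
  have h0 : 0 ≤ L * |t - s| := by positivity
  nlinarith [norm_nonneg (u t - u s)]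

/-- Two solutions with the same initial data, whose velocities are bounded in `V` away from the
initial time, coincide. -/
theorem IsWeakSolution.eq_of_bounded (hι : Function.Injective ι)
    (hB : ∀ x y, 0 ≤ (B x - B y) (x - y)) (hα : ∀ t, 0 ≤ t → 0 < α t)
    {u v u' v' : ℝ → V} {f f' : ℝ → H}
    (h : IsWeakSolution ι B α u v f) (h' : IsWeakSolution ι B α u' v' f') (hu0 : u 0 = u' 0)
    (hv0 : v 0 = v' 0) {b : ℝ}
    (hb : ∀ c ∈ Ioo 0 b, ∃ L, ∀ t ∈ Icc c b, ‖v t‖ ≤ L)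
    (hb' : ∀ c ∈ Ioo 0 b, ∃ L, ∀ t ∈ Icc c b, ‖v' t‖ ≤ L) {t : ℝ} (ht : t ∈ Icc 0 b) :
    u t = u' t ∧ v t = v' t := by
  obtain ⟨S, hS, hd⟩ := h.deriv_v
  obtain ⟨S', hS', hd'⟩ := h'.deriv_v
  set E : ℝ → ℝ := fun t => ‖u t - u' t‖ ^ 2 + ‖ι (v t) - ι (v' t)‖ ^ 2 with hE
  have hEc : ContinuousOn E (Ici 0) :=
    ((h.cont_u.sub h'.cont_u).norm.pow 2).add ((h.cont_v.sub h'.cont_v).norm.pow 2)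
  have hle : E t ≤ E 0 := by
    refine le_of_left_dini_nonpos_off_countable ht.1 (hEc.mono fun x hx => hx.1) (hS.union hS') ?_
    intro τ hτ hτS ε hε
    rw [mem_union, not_or] at hτS
    have hτ0 : 0 < τ := hτ.1
    have hcm : τ / 2 ∈ Ioo 0 b := ⟨by linarith, by linarith [hτ.2, ht.2]⟩
    obtain ⟨L, hL⟩ := hb _ hcm
    obtain ⟨L', hL'⟩ := hb' _ hcm
    have hτm : τ ∈ Icc (τ / 2) b := ⟨by linarith, hτ.2.trans ht.2⟩
    have hL0 : 0 ≤ L := (norm_nonneg _).trans (hL τ hτm)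
    have hL0' : 0 ≤ L' := (norm_nonneg _).trans (hL' τ hτm)
    set q : ℝ → V := fun s => (τ - s)⁻¹ • ((u τ - u' τ) - (u s - u' s)) with hq
    have hqb : ∀ᶠ s in 𝓝[<] τ, ‖q s‖ ≤ L + L' := by
      filter_upwards [Ioo_mem_nhdsLT (show τ / 2 < τ by linarith)] with s hs
      have hsm : s ∈ Icc (τ / 2) b := ⟨hs.1.le, hs.2.le.trans hτm.2⟩
      have h1 := h.norm_position_sub_le hι hcm.1.le hL0 hL hsm hτm
      have h2 := h'.norm_position_sub_le hι hcm.1.le hL0' hL' hsm hτm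
      have hpos : 0 < τ - s := sub_pos.2 hs.2
      rw [abs_of_pos hpos] at h1 h2
      rw [hq]
      simp only
      rw [norm_smul, norm_inv, Real.norm_of_nonneg hpos.le, inv_mul_le_iff₀ hpos,
        sub_sub_sub_comm]
      refine (norm_sub_le _ _).trans ?_
      linarith
    -- The quotients of positions converge only in `H` a priori; their bound in `V`, which needs
    -- bounded velocities, upgrades this to weak convergence in `V`.
    have hqw : WeaklyTendsto q (𝓝[<] τ) (v τ - v' τ) := by
      refine weaklyTendsto_of_map hι hqb (Tendsto.weaklyTendsto ?_)
      rw [map_sub]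
      refine ((tendsto_left_quotient hτ0 (h.deriv_u τ hτ0.le)).sub
        (tendsto_left_quotient hτ0 (h'.deriv_u τ hτ0.le))).congr fun s => ?_
      simp only [hq, map_smul, map_sub]
      rw [← smul_sub, sub_sub_sub_comm]
    set φ := ι (v τ) - ι (v' τ) with hφ
    have hvw : Tendsto (fun s => (τ - s)⁻¹ * ⟪φ - (ι (v s) - ι (v' s)), φ⟫) (𝓝[<] τ)
        (𝓝 (-⟪f τ - f' τ, φ⟫)) := by
      have h1 := (tendsto_left_quotient hτ0 (hd τ hτ0.le hτS.1 φ)).sub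
        (tendsto_left_quotient hτ0 (hd' τ hτ0.le hτS.2 φ))
      rw [neg_sub_neg, ← neg_sub, ← inner_sub_left] at h1
      refine h1.congr fun s => ?_
      simp only [hφ, smul_eq_mul, inner_sub_left]
      ring
    have hlim := ((hqw (u τ - u' τ)).add hvw).const_mul 2
    have hneg : 2 * (⟪v τ - v' τ, u τ - u' τ⟫ + -⟪f τ - f' τ, φ⟫) ≤ 0 := by
      have := (h.state τ hτ0.le).inner_sub_le hB (hα τ hτ0.le).le (h'.state τ hτ0.le)
      rw [sub_self, abs_zero, zero_mul, real_inner_comm, map_sub] at this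
      linarith
    filter_upwards [hlim.eventually (gt_mem_nhds (hneg.trans_lt hε)), self_mem_nhdsWithin]
      with s hs hsτ
    have hpos : 0 < τ - s := sub_pos.2 hsτ
    have h1 := norm_sq_sub_norm_sq_le_two_inner (u τ - u' τ) (u s - u' s)
    have h2 := norm_sq_sub_norm_sq_le_two_inner φ (ι (v s) - ι (v' s))
    have h3 : ⟪u τ - u' τ, u τ - u' τ - (u s - u' s)⟫ = (τ - s) * ⟪q s, u τ - u' τ⟫ := by
      rw [hq]
      simp only
      rw [real_inner_smul_left, mul_inv_cancel_left₀ hpos.ne', real_inner_comm]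
    have h4 : ⟪φ, φ - (ι (v s) - ι (v' s))⟫ =
        (τ - s) * ((τ - s)⁻¹ * ⟪φ - (ι (v s) - ι (v' s)), φ⟫) := by
      rw [mul_inv_cancel_left₀ hpos.ne', real_inner_comm]
    rw [h3] at h1
    rw [h4] at h2
    have h5 := mul_le_mul_of_nonneg_left hs.le hpos.le
    simp only [hE]
    linarith
  have hE0 : E 0 = 0 := by simp [hE, hu0, hv0]
  rw [hE0] at hle
  have h1 : ‖u t - u' t‖ ^ 2 = 0 := by
    refine le_antisymm ?_ (sq_nonneg _)
    simp only [hE] at hle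
    linarith [sq_nonneg ‖ι (v t) - ι (v' t)‖]
  have h2 : ‖ι (v t) - ι (v' t)‖ ^ 2 = 0 := by
    refine le_antisymm ?_ (sq_nonneg _)
    simp only [hE] at hle
    linarith [sq_nonneg ‖u t - u' t‖]
  rw [sq_eq_zero_iff, norm_eq_zero, sub_eq_zero] at h1 h2
  exact ⟨h1, hι h2⟩

theorem IsWeakSolution.isClosed_bounded (hι : Function.Injective ι) (hιd : DenseRange ι)
    (hB : ∀ x y, 0 ≤ (B x - B y) (x - y)) (hBh : Hemicontinuous B)
    (hα : ∀ t, 0 ≤ t → 0 < α t) (hαc : ContinuousOn α (Ici 0))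
    {u v : ℝ → V} {f : ℝ → H} (h : IsWeakSolution ι B α u v f) (L : ℝ) :
    IsClosed {t | 0 ≤ t ∧ ‖v t‖ ≤ L ∧ ‖f t‖ ≤ L} := by
  set F := {t | 0 ≤ t ∧ ‖v t‖ ≤ L ∧ ‖f t‖ ≤ L} with hF
  have hFsub : F ⊆ Ici 0 := fun t ht => ht.1
  refine isClosed_of_closure_subset fun t ht => ?_
  have ht0 : 0 ≤ t := closure_minimal hFsub isClosed_Ici ht
  have hne : (𝓝[F] t).NeBot := mem_closure_iff_nhdsWithin_neBot.1 ht
  have hmem : ∀ᶠ s in 𝓝[F] t, s ∈ F := self_mem_nhdsWithin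
  obtain ⟨v₁, f₁, h1, h2, h3, h4⟩ := StateEq.exists_limit (F := 𝓝[F] t) (L := L) hB hBh
    (hmem.mono fun s hs => h.state s hs.1) (hmem.mono fun s hs => hs.2.1)
    (hmem.mono fun s hs => hs.2.2) ((h.cont_u t ht0).mono hFsub)
    ((h.cont_v t ht0).mono hFsub) ((hαc t ht0).mono hFsub) (hα t ht0)
  obtain rfl := hι h1
  rw [h4.unique hιd (h.state t ht0)] at h3
  exact ⟨ht0, h2, h3⟩

theorem IsWeakSolution.weaklyTendsto (hι : Function.Injective ι) (hιd : DenseRange ι)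
    (hB : ∀ x y, 0 ≤ (B x - B y) (x - y)) (hBh : Hemicontinuous B)
    (hα : ∀ t, 0 ≤ t → 0 < α t) (hαc : ContinuousOn α (Ici 0))
    {u v : ℝ → V} {f : ℝ → H} (h : IsWeakSolution ι B α u v f) {L t : ℝ} (ht : 0 ≤ t)
    (hL : ∀ᶠ s in 𝓝[Ici 0] t, ‖v s‖ ≤ L ∧ ‖f s‖ ≤ L) :
    WeaklyTendsto v (𝓝[Ici 0] t) (v t) ∧ WeaklyTendsto f (𝓝[Ici 0] t) (f t) :=
  StateEq.weaklyTendsto hι hιd hB hBh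
    (eventually_mem_nhdsWithin.mono fun s hs => h.state s hs)
    (hL.mono fun _ h => h.1) (hL.mono fun _ h => h.2) (h.cont_u t ht) (h.cont_v t ht) (hαc t ht)
    (hα t ht) (h.state t ht)

/-- Bound of the rate of change by its value at an earlier time. -/
theorem IsWeakSolution.rate_le (hι : Function.Injective ι) (hιd : DenseRange ι)
    (hB : ∀ x y, 0 ≤ (B x - B y) (x - y)) (hBh : Hemicontinuous B) (hB0 : B 0 = 0)
    (hBb : ∀ L : ℝ, ∃ R, ∀ x, ‖x‖ ≤ L → ‖B x‖ ≤ R)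
    (hα : ∀ T : ℝ, 0 < T → ∃ C, CoeffBound α γ T C)
    {u v : ℝ → V} {f : ℝ → H} (h : IsWeakSolution ι B α u v f) {T C K a t : ℝ}
    (hC : CoeffBound α γ T C) (ha : 0 ≤ a) (hat : a ≤ t) (htT : t ≤ T)
    (hK : ‖u a‖ ^ 2 + ‖ι (v a)‖ ^ 2 ≤ K)
    (hb : ∀ c ∈ Ioo a t, ∃ L, ∀ r ∈ Icc c t, ‖v r‖ ≤ L) :
    rate (α t)⁻¹ (γ t) (u t) (v t) (f t) + K ≤
      Real.exp (192 * C ^ 6 * (t - a)) * (rate (α a)⁻¹ (γ a) (u a) (v a) (f a) + K) := by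
  have hα' : ∀ T : ℝ, 0 < T → ∃ C, CoeffBound (fun s => α (a + s)) (fun s => γ (a + s)) T C :=
    fun T hT => (hα (a + T) (by linarith)).imp fun _ h => h.shift ha
  have hst := h.state a ha
  have hsh := h.shift ha
  -- The solution constructed afresh from the state at time `a` satisfies the bound; uniqueness
  -- identifies it with the given one. Boundedness of the given velocity is required only after `a`,
  -- since `a` may itself be a bad time.
  obtain ⟨u', v', f', h', hu0, hv0, -, -, hrate⟩ := exists_isWeakSolution hι hιd hB hBh hB0 hBb
    hα' (u₀ := u a) (v₀ := v a) (f₀ := f a) (by simpa using hst)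
  have hC' : CoeffBound (fun s => α (a + s)) (fun s => γ (a + s)) (t - a) C :=
    CoeffBound.shift ha (hC.mono (by linarith))
  have hr := hrate (t - a) C K hC' hK
  have hbd : ∃ L, ∀ r ∈ Icc 0 (t - a), ‖v' r‖ ≤ L := by
    obtain ⟨M, hM⟩ := isCompact_Icc.exists_bound_of_continuousOn
      (h'.cont_u.mono (fun x hx => hx.1 : Icc 0 (t - a) ⊆ Ici 0))
    set Y := Real.exp (192 * C ^ 6 * (t - a)) * (rate (α a)⁻¹ (γ a) (u a) (v a) (f a) + K) with hY
    refine ⟨2 * C ^ 2 * max M √Y, fun r hrm => ?_⟩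
    refine (norm_le_of_rate_le hC' hrm (M := max M √Y) (u := u' r) (f := f' r) ?_
      ((hM r hrm).trans (le_max_left _ _))).1
    have hC0 : 0 ≤ C := zero_le_one.trans hC.one_le
    have hK0 : 0 ≤ K := le_trans (by positivity) hK
    have hrn := rate_nonneg (α a)⁻¹ (γ a) (u a) (v a) (f a)
    have hY0 : 0 ≤ Y := by positivity
    have h1 := hr r hrm
    have h2 : Real.exp (192 * C ^ 6 * r) * (rate (α a)⁻¹ (γ a) (u a) (v a) (f a) + K) ≤ Y := by
      rw [hY]
      have := hrm.2
      gcongr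
    simp only [add_zero] at h1
    calc _ ≤ Y := by linarith
      _ = √Y ^ 2 := (Real.sq_sqrt hY0).symm
      _ ≤ _ := by
        gcongr
        exact le_max_right _ _
  have heq := hsh.eq_of_bounded hι hB (fun s hs => CoeffBound.pos_of_forall hα' hs) h'
    (by rw [hu0, add_zero]) (by rw [hv0, add_zero]) (b := t - a)
    (fun c hc => by
      obtain ⟨L, hL⟩ := hb (a + c) ⟨by linarith [hc.1], by linarith [hc.2]⟩
      exact ⟨L, fun r hr => hL _ ⟨by linarith [hr.1], by linarith [hr.2]⟩⟩)
    (fun c hc => hbd.imp fun L hL r hr => hL r ⟨hc.1.le.trans hr.1, hr.2⟩)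
    (t := t - a) ⟨by linarith, le_rfl⟩
  have h1 := hr (t - a) ⟨by linarith, le_rfl⟩
  have hf := h'.state (t - a) (by linarith)
  simp only [add_sub_cancel, add_zero] at h1 heq hf
  rw [← heq.1, ← heq.2] at hf h1
  rwa [hf.unique hιd (h.state t (ha.trans hat))] at h1

end Uniqueness

/-! ### Local boundedness by Baire's theorem, uniqueness, strong differentiability off a countable
set. -/

section Regularity

variable {V H : Type*} [NormedAddCommGroup V] [InnerProductSpace ℝ V]
  [NormedAddCommGroup H] [InnerProductSpace ℝ H] {ι : V →L[ℝ] H} {B : V → StrongDual ℝ V}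
  {α γ : ℝ → ℝ}

/-- Local boundedness on a compact interval is uniform. -/
theorem exists_bound_of_locally_bounded {E : Type*} [Norm E] {v : ℝ → E} {c b : ℝ} (hc : 0 ≤ c)
    (h : ∀ t ∈ Icc c b, ∃ L : ℝ, ∀ᶠ r in 𝓝[Ici 0] t, ‖v r‖ ≤ L) :
    ∃ L : ℝ, ∀ t ∈ Icc c b, ‖v t‖ ≤ L := by
  refine isCompact_Icc.induction_on (p := fun s => ∃ L : ℝ, ∀ t ∈ s, ‖v t‖ ≤ L) ⟨0, by simp⟩
    (fun s t hst ⟨L, hL⟩ => ⟨L, fun r hr => hL r (hst hr)⟩) (fun s t ⟨L, hL⟩ ⟨L', hL'⟩ =>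
      ⟨max L L', fun r hr => hr.elim (fun hr => (hL r hr).trans (le_max_left _ _))
        fun hr => (hL' r hr).trans (le_max_right _ _)⟩) fun t ht => ?_
  obtain ⟨L, hL⟩ := h t ht
  exact ⟨_, nhdsWithin_mono t (fun x hx => hc.trans hx.1) hL, L, fun r hr => hr⟩

/-- A weak derivative is strong where it is strongly continuous. -/
theorem hasDerivWithinAt_of_inner {y f : ℝ → H}
    (h : ∀ t, 0 ≤ t → ∀ φ, HasDerivWithinAt (fun s => ⟪y s, φ⟫) (-⟪f t, φ⟫) (Ici 0) t) {t : ℝ}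
    (ht : 0 ≤ t) (hf : ContinuousWithinAt f (Ici 0) t) :
    HasDerivWithinAt y (-f t) (Ici 0) t := by
  rw [hasDerivWithinAt_iff_isLittleO, Asymptotics.isLittleO_iff]
  intro c hc
  have h1 := hf.eventually (Metric.closedBall_mem_nhds (f t) hc)
  rw [eventually_nhdsWithin_iff, Metric.eventually_nhds_iff] at h1
  obtain ⟨δ, hδ, hball⟩ := h1
  filter_upwards [self_mem_nhdsWithin, mem_nhdsWithin_of_mem_nhds (Metric.ball_mem_nhds t hδ)]
    with s hs hsδ
  -- Testing with the remainder itself recovers its norm from the weak derivative.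
  set φ := y s - y t - (s - t) • -f t with hφ
  have hcv : Convex ℝ (Ici (0 : ℝ) ∩ Metric.ball t δ) := (convex_Ici 0).inter (convex_ball t δ)
  have hd : ∀ r ∈ Ici (0 : ℝ) ∩ Metric.ball t δ, HasDerivWithinAt
      (fun r => ⟪y r, φ⟫ + r * ⟪f t, φ⟫) (-⟪f r, φ⟫ + 1 * ⟪f t, φ⟫)
      (Ici (0 : ℝ) ∩ Metric.ball t δ) r := fun r hr =>
    ((h r hr.1 φ).mono inter_subset_left).add ((hasDerivWithinAt_id r _).mul_const _)
  have h2 := hcv.norm_image_sub_le_of_norm_hasDerivWithin_le (C := c * ‖φ‖) hd (fun r hr => by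
    rw [one_mul, neg_add_eq_sub, ← inner_sub_left]
    refine (norm_inner_le_norm _ _).trans (mul_le_mul_of_nonneg_right ?_ (norm_nonneg _))
    have := hball hr.2 hr.1
    rwa [dist_eq_norm, norm_sub_rev] at this)
    ⟨ht, Metric.mem_ball_self hδ⟩ ⟨hs, hsδ⟩
  have h3 : ⟪y s, φ⟫ + s * ⟪f t, φ⟫ - (⟪y t, φ⟫ + t * ⟪f t, φ⟫) = ‖φ‖ ^ 2 := by
    rw [← real_inner_self_eq_norm_sq]
    conv_rhs => rw [hφ, inner_sub_left, inner_sub_left, real_inner_smul_left, inner_neg_left, ← hφ]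
    ring
  rw [h3, Real.norm_of_nonneg (sq_nonneg _)] at h2
  by_contra hcon
  push Not at hcon
  have h4 : 0 ≤ c * ‖s - t‖ := by positivity
  nlinarith [norm_nonneg φ]

variable [CompleteSpace V] [CompleteSpace H]

/-- The point is that `M` depends on neither `a` nor `t`: in the Baire argument the starting time
varies with the endpoint. -/
theorem IsWeakSolution.exists_bound_of_start (hι : Function.Injective ι) (hιd : DenseRange ι)
    (hB : ∀ x y, 0 ≤ (B x - B y) (x - y)) (hBh : Hemicontinuous B) (hB0 : B 0 = 0)
    (hBb : ∀ L : ℝ, ∃ R, ∀ x, ‖x‖ ≤ L → ‖B x‖ ≤ R)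
    (hα : ∀ T : ℝ, 0 < T → ∃ C, CoeffBound α γ T C)
    {u v : ℝ → V} {f : ℝ → H} (h : IsWeakSolution ι B α u v f) {T : ℝ} (hT : 0 < T) (n : ℝ) :
    ∃ M, ∀ a t, 0 ≤ a → a ≤ t → t ≤ T → ‖v a‖ ≤ n → ‖f a‖ ≤ n →
      (∀ c ∈ Ioo a t, ∃ L, ∀ r ∈ Icc c t, ‖v r‖ ≤ L) → ‖v t‖ ≤ M ∧ ‖f t‖ ≤ M := by
  obtain ⟨C, hC⟩ := hα T hT
  have hsub : Icc 0 T ⊆ Ici 0 := fun x hx => hx.1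
  obtain ⟨P, hP⟩ := isCompact_Icc.exists_bound_of_continuousOn (h.cont_u.mono hsub)
  obtain ⟨W, hW⟩ := isCompact_Icc.exists_bound_of_continuousOn (h.cont_v.mono hsub)
  set K := P ^ 2 + W ^ 2 with hK
  set Q := Real.exp (192 * C ^ 6 * T) * ((C * n + C * P) ^ 2 + (C * n) ^ 2 + K) with hQ
  have hQ0 : 0 ≤ Q := by positivity
  have hC0 : 0 ≤ C := zero_le_one.trans hC.one_le
  refine ⟨2 * C ^ 2 * max P √Q, fun a t ha hat htT hva hfa hb => ?_⟩
  have ham : a ∈ Icc 0 T := ⟨ha, hat.trans htT⟩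
  have htm : t ∈ Icc 0 T := ⟨ha.trans hat, htT⟩
  have hKa : ‖u a‖ ^ 2 + ‖ι (v a)‖ ^ 2 ≤ K := by
    have h1 := hP a ham
    have h2 := hW a ham
    rw [hK]
    gcongr
  have hrate := h.rate_le hι hιd hB hBh hB0 hBb hα hC ha hat htT hKa hb
  have hn0 : 0 ≤ n := (norm_nonneg _).trans hva
  have hbpos : 0 ≤ (α a)⁻¹ := inv_nonneg.2 (hC.pos a ham).le
  have hra : rate (α a)⁻¹ (γ a) (u a) (v a) (f a) ≤ (C * n + C * P) ^ 2 + (C * n) ^ 2 := by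
    have h1 : ‖(α a)⁻¹ • v a + γ a • u a‖ ≤ C * n + C * P := by
      refine (norm_add_le _ _).trans ?_
      rw [norm_smul, norm_smul, Real.norm_of_nonneg hbpos, Real.norm_eq_abs]
      exact add_le_add (mul_le_mul (hC.inv_le a ham) hva (norm_nonneg _) hC0)
        (mul_le_mul (hC.abs_deriv_le a ham) (hP a ham) (norm_nonneg _) hC0)
    have h2 : ‖(α a)⁻¹ • f a‖ ≤ C * n := by
      rw [norm_smul, Real.norm_of_nonneg hbpos]
      exact mul_le_mul (hC.inv_le a ham) hfa (norm_nonneg _) hC0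
    unfold rate
    gcongr
  have hle : rate (α t)⁻¹ (γ t) (u t) (v t) (f t) ≤ Q := by
    have h1 : Real.exp (192 * C ^ 6 * (t - a)) * (rate (α a)⁻¹ (γ a) (u a) (v a) (f a) + K) ≤
        Q := by
      rw [hQ]
      have h2 : t - a ≤ T := by linarith
      have h3 := rate_nonneg (α a)⁻¹ (γ a) (u a) (v a) (f a)
      gcongr
    have hK0 : 0 ≤ K := by positivity
    linarith
  refine norm_le_of_rate_le hC htm (u := u t) ?_ ((hP t htm).trans (le_max_left _ _))
  calc _ ≤ Q := hle
    _ = √Q ^ 2 := (Real.sq_sqrt hQ0).symm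
    _ ≤ _ := by
      gcongr
      exact le_max_right _ _

/-- The velocity of a solution is locally bounded in `V`, by the Baire category theorem. -/
theorem IsWeakSolution.locally_bounded (hι : Function.Injective ι) (hιd : DenseRange ι)
    (hB : ∀ x y, 0 ≤ (B x - B y) (x - y)) (hBh : Hemicontinuous B) (hB0 : B 0 = 0)
    (hBb : ∀ L : ℝ, ∃ R, ∀ x, ‖x‖ ≤ L → ‖B x‖ ≤ R)
    (hα : ∀ T : ℝ, 0 < T → ∃ C, CoeffBound α γ T C)
    {u v : ℝ → V} {f : ℝ → H} (h : IsWeakSolution ι B α u v f) {t : ℝ} (ht : 0 ≤ t) :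
    ∃ L, ∀ᶠ r in 𝓝[Ici 0] t, ‖v r‖ ≤ L ∧ ‖f r‖ ≤ L := by
  by_contra hcon
  set Z : Set ℝ := {t | 0 ≤ t ∧ ¬ ∃ L, ∀ᶠ r in 𝓝[Ici 0] t, ‖v r‖ ≤ L ∧ ‖f r‖ ≤ L} with hZ
  have hZsub : Z ⊆ Ici 0 := fun s hs => hs.1
  have hZcl : IsClosed Z := by
    refine isClosed_of_closure_subset fun s hs => ?_
    refine ⟨closure_minimal hZsub isClosed_Ici hs, ?_⟩
    rintro ⟨L, hL⟩
    have h1 : ∀ᶠ r in 𝓝[Z] s, ∀ᶠ r' in 𝓝[Ici 0] r, ‖v r'‖ ≤ L ∧ ‖f r'‖ ≤ L :=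
      nhdsWithin_mono s hZsub (eventually_eventually_nhdsWithin.2 hL)
    have hne : (𝓝[Z] s).NeBot := mem_closure_iff_nhdsWithin_neBot.1 hs
    obtain ⟨r, hr, hrZ⟩ := (h1.and self_mem_nhdsWithin).exists
    exact hrZ.2 ⟨L, hr⟩
  have hZne : Nonempty Z := ⟨⟨t, ht, hcon⟩⟩
  have hZcomplete : CompleteSpace Z := hZcl.completeSpace_coe
  have hαp : ∀ t, 0 ≤ t → 0 < α t := fun t ht => CoeffBound.pos_of_forall hα ht
  have hcl := fun L => h.isClosed_bounded hι hιd hB hBh hαp (CoeffBound.continuousOn hα) L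
  -- Baire in the complete space `Z`: the closed sets where `v` and `f` are bounded by `n` cover it,
  -- so one of them contains a relative neighbourhood of some `z`.
  obtain ⟨n, z, hz⟩ := nonempty_interior_of_iUnion_of_closed
    (f := fun n : ℕ => ((↑) : Z → ℝ) ⁻¹' {t | 0 ≤ t ∧ ‖v t‖ ≤ (n : ℝ) ∧ ‖f t‖ ≤ (n : ℝ)})
    (fun n => (hcl n).preimage continuous_subtype_val) (by
      refine eq_univ_of_forall fun z => mem_iUnion.2 ?_
      obtain ⟨n, hn⟩ := exists_nat_ge (max ‖v z‖ ‖f z‖)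
      exact ⟨n, z.2.1, (le_max_left _ _).trans hn, (le_max_right _ _).trans hn⟩)
  rw [mem_interior_iff_mem_nhds, Metric.mem_nhds_iff] at hz
  obtain ⟨ε, hε, hball⟩ := hz
  have hZn : ∀ s ∈ Z, |s - z| < ε → ‖v s‖ ≤ n ∧ ‖f s‖ ≤ n := fun s hs hsz =>
    (@hball ⟨s, hs⟩ (by rwa [Metric.mem_ball, Subtype.dist_eq, Real.dist_eq])).2
  have hz0 : 0 ≤ (z : ℝ) := z.2.1
  set s := max 0 ((z : ℝ) - ε / 2) with hs
  have hs0 : 0 ≤ s := le_max_left _ _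
  have hsz : s ≤ z := max_le hz0 (by linarith)
  have hsz' : (z : ℝ) - ε / 2 ≤ s := le_max_right _ _
  set N := max (n : ℝ) (max ‖v s‖ ‖f s‖) with hN
  obtain ⟨M, hM⟩ := h.exists_bound_of_start hι hιd hB hBh hB0 hBb hα
    (T := z + ε / 2) (by linarith) N
  refine z.2.2 ⟨M, ?_⟩
  filter_upwards [self_mem_nhdsWithin, mem_nhdsWithin_of_mem_nhds
    (Ioo_mem_nhds (show (z : ℝ) - ε / 2 < z by linarith) (show (z : ℝ) < z + ε / 2 by linarith))]
    with r hr0 hrz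
  have hsr : s ≤ r := max_le hr0 hrz.1.le
  -- The last bad time before `r`; adding `s` covers the case where there is none in `[s, r]`. No
  -- bad time lies in `(a, r]`, so `v` is bounded on each `[c, r]` with `c > a`, and the state at
  -- `a` is bounded by `N` either way.
  obtain ⟨a, ⟨haZ, har⟩, hmax⟩ := (isCompact_Icc.inter_left
    (hZcl.union (isClosed_singleton (x := s)))).exists_isGreatest
    (⟨s, Or.inr rfl, le_rfl, hsr⟩ : ((Z ∪ {s}) ∩ Icc s r).Nonempty)
  have ha0 : 0 ≤ a := hs0.trans har.1
  have haN : ‖v a‖ ≤ N ∧ ‖f a‖ ≤ N := by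
    rcases haZ with haZ | rfl
    · have := hZn a haZ (abs_lt.2 ⟨by linarith [har.1], by linarith [har.2, hrz.2]⟩)
      exact ⟨this.1.trans (le_max_left _ _), this.2.trans (le_max_left _ _)⟩
    · exact ⟨(le_max_left _ _).trans (le_max_right _ _), (le_max_right _ _).trans
        (le_max_right _ _)⟩
  refine hM a r ha0 har.2 hrz.2.le haN.1 haN.2 fun c hc => ?_
  refine exists_bound_of_locally_bounded (ha0.trans hc.1.le) fun x hx => ?_
  by_contra hxL
  have hxZ : x ∈ Z := ⟨ha0.trans (hc.1.le.trans hx.1), fun ⟨L, hL⟩ =>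
    hxL ⟨L, hL.mono fun _ h => h.1⟩⟩
  have := hmax ⟨Or.inl hxZ, har.1.trans (hc.1.le.trans hx.1), hx.2⟩
  linarith [hc.1, hx.1]

theorem IsWeakSolution.exists_bound (hι : Function.Injective ι) (hιd : DenseRange ι)
    (hB : ∀ x y, 0 ≤ (B x - B y) (x - y)) (hBh : Hemicontinuous B) (hB0 : B 0 = 0)
    (hBb : ∀ L : ℝ, ∃ R, ∀ x, ‖x‖ ≤ L → ‖B x‖ ≤ R)
    (hα : ∀ T : ℝ, 0 < T → ∃ C, CoeffBound α γ T C)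
    {u v : ℝ → V} {f : ℝ → H} (h : IsWeakSolution ι B α u v f) {c b : ℝ} (hc : 0 ≤ c) :
    ∃ L, ∀ t ∈ Icc c b, ‖v t‖ ≤ L :=
  exists_bound_of_locally_bounded hc fun _ ht =>
    (h.locally_bounded hι hιd hB hBh hB0 hBb hα (hc.trans ht.1)).imp fun _ hL =>
      hL.mono fun _ h => h.1

theorem IsWeakSolution.unique (hι : Function.Injective ι) (hιd : DenseRange ι)
    (hB : ∀ x y, 0 ≤ (B x - B y) (x - y)) (hBh : Hemicontinuous B) (hB0 : B 0 = 0)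
    (hBb : ∀ L : ℝ, ∃ R, ∀ x, ‖x‖ ≤ L → ‖B x‖ ≤ R)
    (hα : ∀ T : ℝ, 0 < T → ∃ C, CoeffBound α γ T C)
    {u v u' v' : ℝ → V} {f f' : ℝ → H} (h : IsWeakSolution ι B α u v f)
    (h' : IsWeakSolution ι B α u' v' f') (hu0 : u 0 = u' 0) (hv0 : v 0 = v' 0) :
    EqOn u u' (Ici 0) := fun t ht =>
  (h.eq_of_bounded hι hB (fun _ hs => CoeffBound.pos_of_forall hα hs) h' hu0 hv0 (b := t)
    (fun _ hc => h.exists_bound hι hιd hB hBh hB0 hBb hα hc.1.le)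
    (fun _ hc => h'.exists_bound hι hιd hB hBh hB0 hBb hα hc.1.le) ⟨ht, le_rfl⟩).1

/-- The second derivative of a solution is strongly continuous outside a countable set. -/
theorem IsWeakSolution.countable_not_continuousWithinAt (hι : Function.Injective ι)
    (hιd : DenseRange ι) (hB : ∀ x y, 0 ≤ (B x - B y) (x - y)) (hBh : Hemicontinuous B)
    (hB0 : B 0 = 0) (hBb : ∀ L : ℝ, ∃ R, ∀ x, ‖x‖ ≤ L → ‖B x‖ ≤ R)
    (hα : ∀ T : ℝ, 0 < T → ∃ C, CoeffBound α γ T C)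
    {u v : ℝ → V} {f : ℝ → H} (h : IsWeakSolution ι B α u v f) :
    {t | 0 ≤ t ∧ ¬ ContinuousWithinAt f (Ici 0) t}.Countable := by
  have hαp : ∀ t, 0 ≤ t → 0 < α t := fun t ht => CoeffBound.pos_of_forall hα ht
  have hαc := CoeffBound.continuousOn hα
  set R : ℝ → ℝ := fun t => rate (α t)⁻¹ (γ t) (u t) (v t) (f t) with hR
  have hmain : ∀ T : ℝ, 0 < T → {t | t ∈ Icc 0 T ∧ ¬ ContinuousWithinAt R (Icc 0 T) t}.Countable := by
    intro T hT
    obtain ⟨C, hC⟩ := hα T hT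
    have hsub : Icc 0 T ⊆ Ici 0 := fun x hx => hx.1
    obtain ⟨P, hP⟩ := isCompact_Icc.exists_bound_of_continuousOn (h.cont_u.mono hsub)
    obtain ⟨W, hW⟩ := isCompact_Icc.exists_bound_of_continuousOn (h.cont_v.mono hsub)
    set K := P ^ 2 + W ^ 2 with hK
    have hanti : AntitoneOn (fun t => Real.exp (-(192 * C ^ 6 * t)) * (R t + K)) (Icc 0 T) := by
      intro a ha t ht hat
      have h1 := h.rate_le hι hιd hB hBh hB0 hBb hα hC ha.1 hat ht.2 (K := K) (by
          have h1 := hP a ha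
          have h2 := hW a ha
          rw [hK]
          gcongr)
        fun c hc => h.exists_bound hι hιd hB hBh hB0 hBb hα (ha.1.trans hc.1.le)
      calc Real.exp (-(192 * C ^ 6 * t)) * (R t + K) ≤ Real.exp (-(192 * C ^ 6 * t)) *
            (Real.exp (192 * C ^ 6 * (t - a)) * (R a + K)) := by gcongr
        _ = Real.exp (-(192 * C ^ 6 * a)) * (R a + K) := by
            rw [← mul_assoc, ← Real.exp_add]
            ring_nf
    refine hanti.countable_not_continuousWithinAt.mono fun t ht => ?_
    refine ⟨ht.1, fun hcont => ht.2 ?_⟩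
    have h2 : ContinuousWithinAt (fun t => Real.exp (192 * C ^ 6 * t) *
        (Real.exp (-(192 * C ^ 6 * t)) * (R t + K)) - K) (Icc 0 T) t :=
      ((by fun_prop : Continuous fun t => Real.exp (192 * C ^ 6 * t)).continuousWithinAt.mul
        hcont).sub continuousWithinAt_const
    refine h2.congr (fun s _ => ?_) ?_ <;>
    · rw [← mul_assoc, ← Real.exp_add, add_neg_cancel, Real.exp_zero, one_mul, add_sub_cancel_right]
  refine (countable_iUnion fun n : ℕ => hmain (n + 1) (by positivity)).mono fun t ht => ?_
  obtain ⟨n, hn⟩ := exists_nat_ge t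
  refine mem_iUnion.2 ⟨n, ⟨ht.1, by linarith⟩, fun hcont => ht.2 ?_⟩
  have hnhds : Icc 0 (n + 1 : ℝ) ∈ 𝓝[Ici 0] t := by
    filter_upwards [self_mem_nhdsWithin, mem_nhdsWithin_of_mem_nhds
      (Iic_mem_nhds (show t < n + 1 by linarith))] with s h1 h2 using ⟨h1, h2⟩
  have hRc : Tendsto R (𝓝[Ici 0] t) (𝓝 (R t)) := hcont.mono_of_mem_nhdsWithin hnhds
  obtain ⟨L, hL⟩ := h.locally_bounded hι hιd hB hBh hB0 hBb hα ht.1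
  obtain ⟨hv, hf⟩ := h.weaklyTendsto hι hιd hB hBh hαp hαc ht.1 hL
  have hinv : Tendsto (fun s => (α s)⁻¹) (𝓝[Ici 0] t) (𝓝 (α t)⁻¹) :=
    (hαc t ht.1).tendsto.inv₀ (hαp t ht.1).ne'
  -- Continuity of `R` is convergence of the joint norm of the two weakly convergent vectors in
  -- `rate`; multiplying by `α` then returns from `f / α` to `f`.
  have hF := WeaklyTendsto.tendsto_of_norm_sq_add ((hv.smul hinv).add
    ((h.cont_u t ht.1).tendsto.weaklyTendsto.smul (CoeffBound.continuousOn_deriv hα t ht.1)))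
    (hf.smul hinv) hRc
  have h3 := (hαc t ht.1).tendsto.smul hF
  rw [smul_inv_smul₀ (hαp t ht.1).ne'] at h3
  refine h3.congr' ?_
  filter_upwards [self_mem_nhdsWithin] with s hs
  rw [smul_inv_smul₀ (hαp s hs).ne']

end Regularity

/-! ### The superposition operator on `L²`. -/

section Damping

variable {X : Type*} [MeasurableSpace X] {μ : Measure X} [IsFiniteMeasure μ] {n : ℕ}
  (g : Feedback n)

theorem Feedback.coeFn_superposition (f : L2 μ n) :
    g.superposition f =ᵐ[μ] fun x => g.toFun (f x) := (g.memLp_comp f).coeFn_toLp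

theorem Feedback.superposition_monotone (f f' : L2 μ n) :
    0 ≤ ⟪g.superposition f - g.superposition f', f - f'⟫ := by
  rw [L2.inner_def]
  refine integral_nonneg_of_ae ?_
  filter_upwards [Lp.coeFn_sub (g.superposition f) (g.superposition f'), Lp.coeFn_sub f f',
    g.coeFn_superposition f, g.coeFn_superposition f'] with x h1 h2 h3 h4
  rw [h1, h2, Pi.sub_apply, Pi.sub_apply, h3, h4]
  exact g.monotone _ _

theorem Feedback.superposition_zero : g.superposition (0 : L2 μ n) = 0 := by
  refine Lp.ext ?_
  filter_upwards [g.coeFn_superposition (0 : L2 μ n),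
    Lp.coeFn_zero (EuclideanSpace ℝ (Fin n)) 2 μ] with x h1 h2
  rw [h1, h2, Pi.zero_apply, g.map_zero]

theorem Feedback.exists_norm_superposition_le :
    ∃ M : ℝ, 0 ≤ M ∧ ∀ f : L2 μ n, ‖g.superposition f‖ ≤ M * (1 + ‖f‖) := by
  obtain ⟨M, hM, hg⟩ := g.growth
  set k : Lp ℝ 2 μ := (memLp_const (1 : ℝ)).toLp with hk
  refine ⟨M * (1 + ‖k‖), by positivity, fun f => ?_⟩
  set nf : Lp ℝ 2 μ := (Lp.memLp f).norm.toLp with hnf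
  have hnorm : ‖nf‖ = ‖f‖ := by
    rw [hnf, Lp.norm_toLp, eLpNorm_norm, Lp.norm_def]
  have h1 : ‖g.superposition f‖ ≤ M * ‖k + nf‖ := by
    refine Lp.norm_le_mul_norm_of_ae_le_mul ?_
    filter_upwards [g.coeFn_superposition f, Lp.coeFn_add k nf,
      (memLp_const (1 : ℝ) : MemLp (fun _ : X => (1 : ℝ)) 2 μ).coeFn_toLp,
      (Lp.memLp f).norm.coeFn_toLp] with x h1 h2 h3 h4
    rw [h1, h2, Pi.add_apply, hk, hnf, h3, h4]
    exact (hg (f x)).trans (mul_le_mul_of_nonneg_left (le_abs_self _) hM.le)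
  calc _ ≤ M * ‖k + nf‖ := h1
    _ ≤ M * (‖k‖ + ‖f‖) := by
      rw [← hnorm]
      gcongr
      exact norm_add_le _ _
    _ ≤ _ := by
      rw [mul_assoc]
      gcongr
      nlinarith [norm_nonneg k, norm_nonneg f]

theorem Feedback.tendsto_inner_superposition (f e : L2 μ n) :
    Tendsto (fun t : ℝ => ⟪g.superposition (f + t • e), e⟫) (𝓝[>] 0)
      (𝓝 ⟪g.superposition f, e⟫) := by
  obtain ⟨M, hM, hg⟩ := g.growth
  have hF : ∀ t : ℝ, ⟪g.superposition (f + t • e), e⟫ =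
      ∫ x, ⟪g.toFun (f x + t • e x), e x⟫ ∂μ := by
    intro t
    rw [L2.inner_def]
    refine integral_congr_ae ?_
    filter_upwards [g.coeFn_superposition (f + t • e), Lp.coeFn_add f (t • e),
      Lp.coeFn_smul t e] with x h1 h2 h3
    rw [h1, h2, Pi.add_apply, h3, Pi.smul_apply]
  have hf : ⟪g.superposition f, e⟫ = ∫ x, ⟪g.toFun (f x), e x⟫ ∂μ := by
    simpa using hF 0
  simp only [hF, hf]
  -- For `0 < t < 1` linear growth gives this majorant, integrable as a product of two `L²`
  -- functions.
  refine tendsto_integral_filter_of_dominated_convergence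
    (fun x => M * (1 + ‖f x‖ + ‖e x‖) * ‖e x‖) ?_ ?_ ?_ ?_
  · refine Eventually.of_forall fun t => AEStronglyMeasurable.inner ?_ (Lp.memLp e).1
    exact g.continuous_toFun.comp_aestronglyMeasurable
      ((Lp.memLp f).1.add ((Lp.memLp e).1.const_smul t))
  · filter_upwards [Ioo_mem_nhdsGT (show (0 : ℝ) < 1 by norm_num)] with t ht
    refine Eventually.of_forall fun x => (norm_inner_le_norm _ _).trans ?_
    refine mul_le_mul_of_nonneg_right ((hg _).trans ?_) (norm_nonneg _)
    refine mul_le_mul_of_nonneg_left ?_ hM.le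
    rw [add_assoc]
    refine add_le_add_right ((norm_add_le _ _).trans (add_le_add_right ?_ _)) _
    rw [norm_smul, Real.norm_of_nonneg ht.1.le]
    exact mul_le_of_le_one_left (norm_nonneg _) ht.2.le
  · exact ((((memLp_const (1 : ℝ)).add (Lp.memLp f).norm).add (Lp.memLp e).norm).const_mul
      M).integrable_mul (Lp.memLp e).norm
  · refine Eventually.of_forall fun x => ?_
    have : Continuous fun t : ℝ => ⟪g.toFun (f x + t • e x), e x⟫ :=
      (g.continuous_toFun.comp (by fun_prop)).inner continuous_const
    have h1 := this.tendsto 0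
    rw [zero_smul, add_zero] at h1
    exact h1.mono_left nhdsWithin_le_nhds

end Damping

/-! ### Monotonicity, hemicontinuity and boundedness of `B₂`. -/

section DampingOperator

variable {V : Type*} [NormedAddCommGroup V] [InnerProductSpace ℝ V] {J : ℕ}
  {X : Fin J → Type*} [∀ j, MeasurableSpace (X j)] {μ : ∀ j, Measure (X j)}
  [∀ j, IsFiniteMeasure (μ j)] {N : Fin J → ℕ} {U : ∀ j, Submodule ℝ (L2 (μ j) (N j))}
  (g : ∀ j, Feedback (N j)) (JU : V →L[ℝ] (∀ j, U j))

theorem damping_eq_sum_inner (u v : V) :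
    damping g JU u v =
      ∑ j, ⟪(g j).superposition (JU u j : L2 (μ j) (N j)), (JU v j : L2 (μ j) (N j))⟫ := by
  simp only [damping, sum_apply]
  rfl

theorem damping_monotone (x y : V) : 0 ≤ (damping g JU x - damping g JU y) (x - y) := by
  rw [sub_apply, damping_eq_sum_inner, damping_eq_sum_inner, ← Finset.sum_sub_distrib]
  refine Finset.sum_nonneg fun j _ => ?_
  rw [← inner_sub_left, map_sub, Pi.sub_apply, Submodule.coe_sub]
  exact (g j).superposition_monotone _ _

theorem damping_zero : damping g JU 0 = 0 := by
  ext v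
  rw [damping_eq_sum_inner]
  refine Finset.sum_eq_zero fun j _ => ?_
  rw [map_zero, Pi.zero_apply, Submodule.coe_zero, (g j).superposition_zero, inner_zero_left]

theorem damping_hemicontinuous : Hemicontinuous (damping g JU) := by
  intro x h
  simp only [damping_eq_sum_inner]
  refine tendsto_finsetSum _ fun j _ => ?_
  simp only [map_add, map_smul, Pi.add_apply, Pi.smul_apply, Submodule.coe_add, Submodule.coe_smul]
  exact (g j).tendsto_inner_superposition _ _

theorem damping_bounded (L : ℝ) : ∃ R, ∀ x, ‖x‖ ≤ L → ‖damping g JU x‖ ≤ R := by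
  choose M hM0 hM using fun j => (g j).exists_norm_superposition_le (μ := μ j)
  have hJ : ∀ j x, ‖(JU x j : L2 (μ j) (N j))‖ ≤ ‖JU‖ * ‖x‖ := fun j x =>
    (norm_le_pi_norm (JU x) j).trans (JU.le_opNorm x)
  refine ⟨∑ j, M j * (1 + ‖JU‖ * L) * ‖JU‖, fun x hx => ?_⟩
  have hL : 0 ≤ L := (norm_nonneg _).trans hx
  refine ContinuousLinearMap.opNorm_le_bound _ (Finset.sum_nonneg fun j _ => by
    have := hM0 j
    positivity) fun v => ?_
  rw [damping_eq_sum_inner, Finset.sum_mul]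
  refine (norm_sum_le _ _).trans (Finset.sum_le_sum fun j _ => ?_)
  refine (norm_inner_le_norm _ _).trans ?_
  rw [mul_assoc]
  refine mul_le_mul ((hM j _).trans (mul_le_mul_of_nonneg_left ?_ (hM0 j))) (hJ j v)
    (norm_nonneg _) (mul_nonneg (hM0 j) (by positivity))
  have := (hJ j x).trans (mul_le_mul_of_nonneg_left hx (norm_nonneg JU))
  linarith

end DampingOperator

/-! ### Bounds for `α` and `1 / α`. -/

section Coefficient

theorem exists_coeffBound {α : ℝ → ℝ} (hα_pos : ∀ t ∈ Ici (0 : ℝ), 0 < α t)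
    (hα_C1 : ContDiffOn ℝ 1 α (Ici 0))
    (hα_lip : ∀ T : ℝ, 0 < T → ∃ ν : ℝ, 0 < ν ∧ ∀ s ∈ Icc (0 : ℝ) T, ∀ t ∈ Icc (0 : ℝ) T,
      |derivWithin α (Ici 0) t - derivWithin α (Ici 0) s| ≤ ν * |t - s|) (T : ℝ) (hT : 0 < T) :
    ∃ C, CoeffBound α (fun t => -derivWithin α (Ici 0) t / α t ^ 2) T C := by
  set α' := derivWithin α (Ici 0) with hα'
  have hsub : Icc 0 T ⊆ Ici 0 := fun x hx => hx.1
  have hαc : ContinuousOn α (Ici 0) := hα_C1.continuousOn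
  have hα'c : ContinuousOn α' (Ici 0) :=
    hα_C1.continuousOn_derivWithin (uniqueDiffOn_Ici 0) le_rfl
  have hd : ∀ t, 0 ≤ t → HasDerivWithinAt α (α' t) (Ici 0) t := fun t ht =>
    (hα_C1.differentiableOn one_ne_zero t ht).hasDerivWithinAt
  have hdi : ∀ t, 0 ≤ t → HasDerivWithinAt (fun s => (α s)⁻¹) (-α' t / α t ^ 2) (Ici 0) t :=
    fun t ht => (hd t ht).fun_inv (hα_pos t ht).ne'
  obtain ⟨ν, hν, hlip⟩ := hα_lip T hT
  have hbounded : ∀ a : ℝ → ℝ, ContinuousOn a (Ici 0) → ∃ A : ℝ, 0 ≤ A ∧ ∀ t ∈ Icc 0 T, |a t| ≤ A := by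
    intro a ha
    obtain ⟨A, hA⟩ := isCompact_Icc.exists_bound_of_continuousOn (ha.mono hsub)
    exact ⟨A, (norm_nonneg _).trans (hA 0 ⟨le_rfl, hT.le⟩), hA⟩
  have hic : ContinuousOn (fun t => (α t)⁻¹) (Ici 0) := hαc.inv₀ fun t ht => (hα_pos t ht).ne'
  have hγc : ContinuousOn (fun t => -α' t / α t ^ 2) (Ici 0) :=
    hα'c.neg.div (hαc.pow 2) fun t ht => pow_ne_zero 2 (hα_pos t ht).ne'
  obtain ⟨A, hA0, hA⟩ := hbounded α hαc
  obtain ⟨b, hb0, hb⟩ := hbounded _ hic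
  obtain ⟨D, hD0, hD⟩ := hbounded α' hα'c
  obtain ⟨G, hG0, hG⟩ := hbounded _ hγc
  have hmean : ∀ (a a' : ℝ → ℝ) (L : ℝ) (s t : ℝ), s ∈ Icc 0 T → t ∈ Icc 0 T →
      (∀ r ∈ uIcc s t, HasDerivWithinAt a (a' r) (Ici 0) r) → (∀ r ∈ uIcc s t, |a' r| ≤ L) →
      |a t - a s| ≤ L * |t - s| := by
    intro a a' L s t hs ht hd hL
    have hst : uIcc s t ⊆ Ici 0 := (uIcc_subset_Icc hs ht).trans hsub
    exact (convex_uIcc s t).norm_image_sub_le_of_norm_hasDerivWithin_le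
      (fun r hr => (hd r hr).mono hst) hL left_mem_uIcc right_mem_uIcc
  have hmem : ∀ {s t r}, s ∈ Icc 0 T → t ∈ Icc 0 T → r ∈ uIcc s t → r ∈ Icc 0 T :=
    fun hs ht hr => uIcc_subset_Icc hs ht hr
  have hlipi : ∀ s ∈ Icc 0 T, ∀ t ∈ Icc 0 T, |(α t)⁻¹ - (α s)⁻¹| ≤ G * |t - s| :=
    fun s hs t ht => hmean _ _ G s t hs ht (fun r hr => hdi r (hmem hs ht hr).1)
      fun r hr => hG r (hmem hs ht hr)
  set P := ν * b ^ 2 + D * (2 * b * G) with hP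
  have hlipγ : ∀ s ∈ Icc 0 T, ∀ t ∈ Icc 0 T,
      |-α' t / α t ^ 2 - -α' s / α s ^ 2| ≤ P * |t - s| := by
    intro s hs t ht
    have e : -α' t / α t ^ 2 - -α' s / α s ^ 2 =
        -(α' t - α' s) * ((α t)⁻¹ * (α t)⁻¹) -
          α' s * (((α t)⁻¹ + (α s)⁻¹) * ((α t)⁻¹ - (α s)⁻¹)) := by
      have h1 := (hα_pos t ht.1).ne'
      have h2 := (hα_pos s hs.1).ne'
      field_simp
      ring
    rw [e]
    calc _ ≤ |α' t - α' s| * (|(α t)⁻¹| * |(α t)⁻¹|) +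
          |α' s| * ((|(α t)⁻¹| + |(α s)⁻¹|) * |(α t)⁻¹ - (α s)⁻¹|) := by
          refine (abs_sub _ _).trans ?_
          rw [abs_mul, abs_neg, abs_mul, abs_mul, abs_mul]
          gcongr
          exact abs_add_le _ _
      _ ≤ (ν * |t - s|) * (b * b) + D * ((b + b) * (G * |t - s|)) := by
          have h1 := hlip s hs t ht
          have h2 := hb t ht
          have h3 := hb s hs
          have h4 := hD s hs
          have h5 := hlipi s hs t ht
          gcongr
      _ = P * |t - s| := by rw [hP]; ring
  have hP0 : 0 ≤ P := by positivity
  refine ⟨1 + A + b + D + G + P, by linarith, fun t ht => hα_pos t ht.1,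
    fun t ht => (le_abs_self _).trans ((hA t ht).trans (by linarith)),
    fun t ht => (le_abs_self _).trans ((hb t ht).trans (by linarith)),
    fun t ht => (hG t ht).trans (by linarith), fun s hs t ht => ?_, fun s hs t ht => ?_,
    fun s hs t ht => ?_, fun s hs t ht => ?_⟩
  · refine (hmean _ _ D s t hs ht (fun r hr => hd r (hmem hs ht hr).1)
      fun r hr => hD r (hmem hs ht hr)).trans ?_
    gcongr
    linarith
  · refine (hlipi s hs t ht).trans ?_
    gcongr
    linarith
  · refine (hlipγ s hs t ht).trans ?_
    gcongr
    linarith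
  -- Taylor bound: subtracting the tangent slope at `t` leaves a function with derivative `γ r - γ
  -- t`, at most `P * |t - s|` in size between `s` and `t`.
  · have h1 := hmean (fun r => (α r)⁻¹ - (-α' t / α t ^ 2) * r)
      (fun r => -α' r / α r ^ 2 - (-α' t / α t ^ 2) * 1) (P * |t - s|) s t hs ht
      (fun r hr => (hdi r (hmem hs ht hr).1).sub ((hasDerivWithinAt_id r _).const_mul _))
      (fun r hr => by
        rw [mul_one]
        refine (hlipγ t ht r (hmem hs ht hr)).trans ?_
        refine mul_le_mul_of_nonneg_left ?_ hP0
        rw [abs_sub_comm t s]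
        exact abs_sub_left_of_mem_uIcc (by rwa [uIcc_comm]))
    have h2 : P * |t - s| * |t - s| = P * (t - s) ^ 2 := by rw [mul_assoc, abs_mul_abs_self, sq]
    calc _ = |(α t)⁻¹ - (-α' t / α t ^ 2) * t - ((α s)⁻¹ - (-α' t / α t ^ 2) * s)| := by
          congr 1; ring
      _ ≤ P * (t - s) ^ 2 := h2 ▸ h1
      _ ≤ _ := by
          gcongr
          linarith

end Coefficient

theorem IsSolution.exists_isWeakSolution {V H : Type*} [NormedAddCommGroup V]
    [InnerProductSpace ℝ V] [NormedAddCommGroup H] [InnerProductSpace ℝ H] {ι : V →L[ℝ] H}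
    {B : V → StrongDual ℝ V} {α : ℝ → ℝ} {u₀ u₁ : V} {u : ℝ → V}
    (h : IsSolution ι (stiffness V) B α u₀ u₁ u) :
    ∃ v f, IsWeakSolution ι B α u v f ∧ u 0 = u₀ ∧ v 0 = u₁ := by
  obtain ⟨hu, hu0, v, hd, hv, hv0, f, hf, S, hS, hdv⟩ := h
  refine ⟨v, f, ⟨hu, hv, hd, fun t ht => pivot_eq_iff.1 (hf t ht), S, hS, fun t ht htS φ => ?_⟩,
    hu0, hv0⟩
  have := (hdv t ⟨ht, htS⟩).1.inner ℝ (hasDerivWithinAt_const t (Ici 0) φ)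
  simpa using this

end

theorem mainTheorem8
    {V H : Type*}
    [NormedAddCommGroup V] [InnerProductSpace ℝ V] [CompleteSpace V]
    [TopologicalSpace.SeparableSpace V]
    [NormedAddCommGroup H] [InnerProductSpace ℝ H] [CompleteSpace H]
    [TopologicalSpace.SeparableSpace H]
    (ι : V →L[ℝ] H) (hι_inj : Function.Injective ι) (hι_dense : DenseRange ι)
    {J : ℕ} {X : Fin J → Type*} [∀ j, MeasurableSpace (X j)]
    (μ : ∀ j, Measure (X j)) [∀ j, IsFiniteMeasure (μ j)] (N : Fin J → ℕ)
    (U : ∀ j, Submodule ℝ (L2 (μ j) (N j)))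
    (hU : ∀ j, IsClosed (U j : Set (L2 (μ j) (N j))))
    (JU : V →L[ℝ] (∀ j, U j)) (g : ∀ j, Feedback (N j))
    (α : ℝ → ℝ) (hα_pos : ∀ t ∈ Ici (0 : ℝ), 0 < α t) (hα_C1 : ContDiffOn ℝ 1 α (Ici 0))
    (hα_lip : ∀ T : ℝ, 0 < T → ∃ ν : ℝ, 0 < ν ∧ ∀ s ∈ Icc (0 : ℝ) T, ∀ t ∈ Icc (0 : ℝ) T,
      |derivWithin α (Ici 0) t - derivWithin α (Ici 0) s| ≤ ν * |t - s|)
    (u₀ u₁ : V)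
    (hu : ∃ h : H, pivot ι h = stiffness V u₀ + α 0 • damping g JU u₁) :
    ∃ u : ℝ → V, IsSolution ι (stiffness V) (damping g JU) α u₀ u₁ u ∧
      ∀ w : ℝ → V, IsSolution ι (stiffness V) (damping g JU) α u₀ u₁ w →
        EqOn w u (Ici 0) := by
  obtain ⟨f₀, hf₀⟩ := hu
  have hα := exists_coeffBound hα_pos hα_C1 hα_lip
  have hB := damping_monotone g JU
  have hBh := damping_hemicontinuous g JU
  have hB0 := damping_zero g JU
  have hBb := damping_bounded g JU
  obtain ⟨u, v, f, hw, hu0, hv0, -, hdv, -⟩ :=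
    exists_isWeakSolution hι_inj hι_dense hB hBh hB0 hBb hα (pivot_eq_iff.1 hf₀)
  refine ⟨u, ⟨hw.cont_u, hu0, v, fun t ht => hw.deriv_u t ht, hw.cont_v, hv0, f,
    fun t ht => pivot_eq_iff.2 (hw.state t ht), _,
    hw.countable_not_continuousWithinAt hι_inj hι_dense hB hBh hB0 hBb hα, ?_⟩, fun w h => ?_⟩
  · rintro t ⟨ht, htS⟩
    have hft : ContinuousWithinAt f (Ici 0) t := by
      by_contra hcon
      exact htS ⟨ht, hcon⟩
    exact ⟨hasDerivWithinAt_of_inner hdv ht hft, hft⟩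
  · obtain ⟨v', f', hw', hu0', hv0'⟩ := h.exists_isWeakSolution
    exact hw'.unique hι_inj hι_dense hB hBh hB0 hBb hα hw (hu0'.trans hu0.symm)
      (hv0'.trans hv0.symm)
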